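/- Let $N\ge 3$, $\alpha\in[1,2)$, $m_1,\dots,m_N>0$, $M=\sum_k m_k$, and let $c_1,\dots,c_N\in\mathbb{C}=\mathbb{R}^2$, not all zero, have centre of mass $\sum_k m_kc_k=0$. For $\varepsilon>0$ let $c_k'=\varepsilon c_k/\max_j|c_j|$ (so that $\max_k|c_k'|=\varepsilon$), and for $\nu'\in\mathbb{R}$ put $$V_\varepsilon(y)=\sum_{k=1}^N\frac{m_k}{\alpha|y-c_k'|^\alpha},\qquad \Phi_{\nu',\varepsilon}(y)=\frac{(\nu')^2}{2}|y|^2+V_\varepsilon(y),\qquad R=\Big(\frac{(2-\alpha)M}{2\alpha}\Big)^{1/\alpha}.$$ Let $B_R=\{|y|<R\}$. For $p_0,p_1\in\partial B_R$, an outer solution from $p_0$ to $p_1$ is a pair $(T,y)$ with $T>0$ and $y\in C^2([0,T];\mathbb{C})$ such that $$\ddot y+2\nu' i\,\dot y=\nabla\Phi_{\nu',\varepsilon}(y),\quad \tfrac12|\dot y|^2-\Phi_{\nu',\varepsilon}(y)=-1\ \text{ on }[0,T],\quad |y(t)|>R\ \text{ on }(0,T),\quad y(0)=p_0,\ y(T)=p_1.$$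 Its initial angular velocity is the real number $\dot\vartheta_0$ for which $\dot y(0)=(\dot r_0+iR\dot\vartheta_0)\,p_0/R$ with $\dot r_0\in\mathbb{R}$. **Proposition.** There are $\delta,\varepsilon_2,\nu_1'>0$ and $\eta>0$ such that for all $\varepsilon\in(0,\varepsilon_2)$ and $\nu'\in(-\nu_1',\nu_1')$ and all $p_0,p_1\in\partial B_R$ with $|p_0-p_1|<2\delta$ there is exactly one outer solution $y_{\rm ext}(\cdot\,;p_0,p_1;\varepsilon,\nu')$, with $T=T_{\rm ext}(p_0,p_1;\varepsilon,\nu')$, from $p_0$ to $p_1$ whose initial angular velocity satisfies $|\dot\vartheta_0|<\eta$ (whatever $T>0$ is). It depends in a $C^1$ way on the endpoints: with $p_j=Re^{i\vartheta_j}$, $T_{\rm ext}$ is a $C^1$ function of $(\vartheta_0,\vartheta_1)$, and $y_{\rm ext}(sT_{\rm ext})$ and $\dot y_{\rm ext}(sT_{\rm ext})$ are $C^1$ functions of $(s,\vartheta_0,\vartheta_1)$, $s\in[0,1]$, where $|p_0-p_1|<2\delta$. Moreover, for all these $p_0,p_1,\varepsilon,\nu'$, $$\max_{[0,T_{\rm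 ext}]}|y_{\rm ext}|\le 2\Big(\frac M\alpha\Big)^{1/\alpha},\qquad \max_{[0,T_{\rm ext}]}|\dot y_{\rm ext}|\le 2\sqrt{2\Big(-1+\frac{M}{\alpha R^\alpha}\Big)}.$$ -/

import Mathlib

open Set

noncomputable section

namespace RotatingCentres

variable {N : ℕ}

/-- Total mass `M = ∑ m_k`. -/
def totalMass (m : Fin N → ℝ) : ℝ := ∑ k, m k

/-- The rescaled centres `c'_k`: the configuration `c`, dilated so that `max_k |c'_k| = ε`.
(The norm of `c : Fin N → ℂ` is `max_k |c_k|`.) -/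
def scaledCentres (ε : ℝ) (c : Fin N → ℂ) (k : Fin N) : ℂ := ((ε / ‖c‖ : ℝ) : ℂ) * c k

theorem norm_scaledCentres {ε : ℝ} (hε : 0 ≤ ε) {c : Fin N → ℂ} (hc : c ≠ 0) :
    ‖scaledCentres ε c‖ = ε := by
  have h : scaledCentres ε c = ((ε / ‖c‖ : ℝ)) • c := by
    funext k
    simp [scaledCentres]
  have hn : ‖c‖ ≠ 0 := norm_ne_zero_iff.mpr hc
  rw [h, norm_smul, Real.norm_of_nonneg (by positivity)]
  field_simp

/-- `V_ε(z) = ∑ m_k / (α |z - c'_k|^α)`. -/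
def potential (α : ℝ) (m : Fin N → ℝ) (c : Fin N → ℂ) (ε : ℝ) (z : ℂ) : ℝ :=
  ∑ k, m k / (α * ‖z - scaledCentres ε c k‖ ^ α)

/-- `Φ_{ν,ε}(z) = ν² |z|² / 2 + V_ε(z)`. -/
def effectivePotential (α : ℝ) (m : Fin N → ℝ) (c : Fin N → ℂ) (ε ν : ℝ) (z : ℂ) : ℝ :=
  ν ^ 2 / 2 * ‖z‖ ^ 2 + potential α m c ε z

/-- `R = ((2 - α) M / (2 α)) ^ (1 / α)`, the radius of the circular solution of energy `-1` of
the `α`-Kepler problem with mass `M`. -/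
def circularRadius (α M : ℝ) : ℝ := ((2 - α) * M / (2 * α)) ^ (1 / α)

/-- The velocity on `[0, T]` (one-sided at the two ends). -/
def velocity (T : ℝ) (y : ℝ → ℂ) (t : ℝ) : ℂ := derivWithin y (Icc 0 T) t

/-- The acceleration on `[0, T]` (one-sided at the two ends). -/
def acceleration (T : ℝ) (y : ℝ → ℂ) (t : ℝ) : ℂ := derivWithin (velocity T y) (Icc 0 T) t

/-- Angular velocity at the position `p` with velocity `v`: if `p = r e^{iθ}` and
`v = a e^{iθ} + r b i e^{iθ}` with `a`, `b` real and `r > 0`, this is `b`. -/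
def angularVelocity (p v : ℂ) : ℝ := (starRingEnd ℂ p * v).im / ‖p‖ ^ 2

/-- `y`, restricted to `[0, T]`, is a classical solution, with Jacobi constant `-1`, of the
rotating problem with centres `c'_k` and angular velocity `ν`, which goes from `p₀` to `p₁` and
stays outside the closed ball `{|z| ≤ R}` at the intermediate times. -/
structure IsOuterSolution (α : ℝ) (m : Fin N → ℝ) (c : Fin N → ℂ) (ε ν : ℝ) (p₀ p₁ : ℂ)
    (T : ℝ) (y : ℝ → ℂ) : Prop where
  time_pos : 0 < T
  contDiffOn : ContDiffOn ℝ 2 y (Icc 0 T)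
  motion : ∀ t ∈ Icc 0 T, acceleration T y t + 2 * (ν : ℂ) * Complex.I * velocity T y t
    = gradient (effectivePotential α m c ε ν) (y t)
  jacobi : ∀ t ∈ Icc 0 T,
    1 / 2 * ‖velocity T y t‖ ^ 2 - effectivePotential α m c ε ν (y t) = -1
  outside : ∀ t ∈ Ioo 0 T, circularRadius α (totalMass m) < ‖y t‖
  start : y 0 = p₀
  finish : y T = p₁

/-- The point `R e^{iθ}` of the circle of radius `R`. -/
def circlePoint (R θ : ℝ) : ℂ := (R : ℂ) * Complex.exp ((θ : ℂ) * Complex.I)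

/-- The pairs of angles `(θ₀, θ₁)` with `|R e^{iθ₀} - R e^{iθ₁}| < 2δ`. -/
def closeAngles (R δ : ℝ) : Set (ℝ × ℝ) :=
  {θ | ‖circlePoint R θ.1 - circlePoint R θ.2‖ < 2 * δ}

/-- `C¹` dependence on the endpoints of a family of times `T p₀ p₁` and of curves
`y p₀ p₁ : [0, T p₀ p₁] → ℂ`, indexed by the points of the circle of radius `R` with
`|p₀ - p₁| < 2δ`. The circle is parametrized by the angle, and the curves by `s ∈ [0, 1]` through
`t = s T`; the time, the position and the velocity are then functions of class `C¹`. -/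
structure IsC1InEndpoints (R δ : ℝ) (T : ℂ → ℂ → ℝ) (y : ℂ → ℂ → ℝ → ℂ) : Prop where
  time : ContDiffOn ℝ 1
    (fun θ : ℝ × ℝ => T (circlePoint R θ.1) (circlePoint R θ.2)) (closeAngles R δ)
  position : ContDiffOn ℝ 1
    (fun q : ℝ × ℝ × ℝ => y (circlePoint R q.2.1) (circlePoint R q.2.2)
      (q.1 * T (circlePoint R q.2.1) (circlePoint R q.2.2)))
    (Icc 0 1 ×ˢ closeAngles R δ)
  velocity : ContDiffOn ℝ 1
    (fun q : ℝ × ℝ × ℝ => RotatingCentres.velocity (T (circlePoint R q.2.1) (circlePoint R q.2.2))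
      (y (circlePoint R q.2.1) (circlePoint R q.2.2))
      (q.1 * T (circlePoint R q.2.1) (circlePoint R q.2.2)))
    (Icc 0 1 ×ˢ closeAngles R δ)

end RotatingCentres

end

/-! For `ε = ν = 0` the system is the `α`-Kepler problem with the whole mass `M` at the origin. At
energy `-1` the speed on the circle of radius `R` is positive, because `M / (α R^α) = 2 / (2 - α) >
1`. The radial orbit leaving a point of the circle therefore goes out, cannot pass the turning
radius `(M / α) ^ (1 / α)`, and falls back to the same point at a time `T₀`, with strictly inward
velocity (`exists_isRadialOrbit`). The outer solutions are continued from this orbit.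

A rotation brings `p₀` to the point `R`. Energy, initial angular velocity `ω` and the outward
direction then determine the initial velocity, so the orbits form a `C¹` family `Z t (a, ν, ω)` in
the centres `a`, the frame velocity `ν` and `ω` (`exists_isOrbitFamily`). An outer solution to `u`
is a zero `(t, ω)` of `Z t (a, ν, ω) - u`, and the implicit function theorem applies at `(T₀, 0)`.
Indeed the derivative in `t` is the radial velocity, real and nonzero, while the derivative in `ω`
has positive imaginary part, since the conserved angular momentum `R² ω` forces the polar angle to
grow at a rate bounded below by a multiple of `ω` (`IsOrbitFamily.isInvertible_fderiv_shootingMap`).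

The implicit function theorem gives uniqueness only for `t` near `T₀`. To have it for every `T`,
`IsOrbitFamily.exists_eventually_returnsNear` shows that all orbits with small parameters are
outside the disc until just before `T₀` and inside it just after, so the return time is confined to
the neighbourhood where uniqueness holds. The bounds hold with a factor 2 to spare on the radial
orbit and survive the perturbation.

The `C¹` flow is obtained by the implicit function theorem in `C([a, b], E)` for the integral
equation `u = x + ∫ X(u)`: composition with `X` is `C¹` on this space, and the linearisation is the
identity minus a Volterra operator, which is invertible. -/

open Set

noncomputable section

namespace RotatingCentres

/-! ### Composition operators on spaces of continuous functions -/

section Nemytskii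

open Filter Topology

variable {K E F : Type*} [TopologicalSpace K] [CompactSpace K]
  [NormedAddCommGroup E] [NormedSpace ℝ E] [NormedAddCommGroup F] [NormedSpace ℝ F]

/-- The pairing `(A, v) ↦ (t ↦ A t (v t))` of continuous families of operators and of vectors. -/
def pointwiseApply : C(K, E →L[ℝ] F) →L[ℝ] C(K, E) →L[ℝ] C(K, F) :=
  LinearMap.mkContinuous₂
    (LinearMap.mk₂ ℝ
      (fun (A : C(K, E →L[ℝ] F)) (v : C(K, E)) => (⟨fun t => A t (v t), by fun_prop⟩ : C(K, F)))
      (fun A B v => by ext t; simp) (fun a A v => by ext t; simp)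
      (fun A v w => by ext t; simp) (fun a A v => by ext t; simp))
    1 (fun A v => by
      rw [ContinuousMap.norm_le _ (by positivity)]
      intro t
      calc ‖A t (v t)‖ ≤ ‖A t‖ * ‖v t‖ := (A t).le_opNorm _
        _ ≤ 1 * ‖A‖ * ‖v‖ := by
          rw [one_mul]
          gcongr
          · exact A.norm_coe_le_norm t
          · exact v.norm_coe_le_norm t)

@[simp]
theorem pointwiseApply_apply (A : C(K, E →L[ℝ] F)) (v : C(K, E)) (t : K) :
    pointwiseApply A v t = A t (v t) := rfl

theorem hasFDerivAt_postcomp {X : E → F} (hX : ContDiff ℝ 1 X) (u : C(K, E)) :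
    HasFDerivAt (fun u : C(K, E) => (⟨X, hX.continuous⟩ : C(E, F)).comp u)
      (pointwiseApply
        ((⟨fderiv ℝ X, hX.continuous_fderiv one_ne_zero⟩ : C(E, E →L[ℝ] F)).comp u)) u := by
  set D : C(E, E →L[ℝ] F) := ⟨fderiv ℝ X, hX.continuous_fderiv one_ne_zero⟩ with hD
  rw [hasFDerivAt_iff_isLittleO, Asymptotics.isLittleO_iff]
  intro c hc
  have hcont : Continuous fun w : C(K, E) => D.comp w := D.continuous_postcomp
  obtain ⟨δ, hδ, hball⟩ := (Metric.continuous_iff (α := C(K, E)) (β := C(K, E →L[ℝ] F))).mp hcont u c hc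
  filter_upwards [Metric.ball_mem_nhds u hδ] with w hw
  rw [ContinuousMap.norm_le _ (by positivity)]
  intro t
  have hwt : w t ∈ Metric.ball (u t) δ :=
    lt_of_le_of_lt (ContinuousMap.dist_apply_le_dist t) hw
  have hder : ∀ x ∈ Metric.ball (u t) δ, ‖fderiv ℝ X x - fderiv ℝ X (u t)‖ ≤ c := by
    intro x hx
    -- Continuity of `w ↦ D ∘ w` at `u` supplies a `δ` uniform in `t`: the translate of `u` by the
    -- constant `x - u t` is within `δ` of `u` and takes the value `x` at `t`.
    have h1 := hball (u + ContinuousMap.const K (x - u t)) (by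
      refine lt_of_le_of_lt ?_ hx
      rw [ContinuousMap.dist_le dist_nonneg]
      intro s
      simp [dist_eq_norm])
    have h2 := lt_of_le_of_lt (ContinuousMap.dist_apply_le_dist t) h1
    simpa [hD, dist_eq_norm] using h2.le
  have := Convex.norm_image_sub_le_of_norm_hasFDerivWithin_le'
    (fun x _ => ((hX.differentiable one_ne_zero).differentiableAt
      (x := x)).hasFDerivAt.hasFDerivWithinAt) hder
    (convex_ball _ _) (Metric.mem_ball_self hδ) hwt
  refine this.trans ?_
  gcongr
  exact (w - u).norm_coe_le_norm t

theorem contDiff_postcomp {X : E → F} (hX : ContDiff ℝ 1 X) :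
    ContDiff ℝ 1 fun u : C(K, E) => (⟨X, hX.continuous⟩ : C(E, F)).comp u :=
  contDiff_one_iff_hasFDerivAt.mpr ⟨_, pointwiseApply.continuous.comp
    (ContinuousMap.continuous_postcomp _), hasFDerivAt_postcomp hX⟩

end Nemytskii

/-! ### Invertibility of the identity minus a Volterra operator -/

section Volterra

open MeasureTheory

variable {E : Type*} [NormedAddCommGroup E] [NormedSpace ℝ E] {a b : ℝ}

/-- `w ↦ (t ↦ ∫₀ᵗ w)` on `C([a, b], E)`, where `[a, b]` contains `0`. -/
def primitiveCLM (ha : a ≤ 0) (hb : 0 ≤ b) : C(Icc a b, E) →L[ℝ] C(Icc a b, E) :=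
  LinearMap.mkContinuous
    { toFun := fun w => ⟨fun t => ∫ s in (0 : ℝ)..t, IccExtend (ha.trans hb) w s,
        (intervalIntegral.continuous_primitive
          (fun _ _ => (w.continuous.Icc_extend' ).intervalIntegrable _ _) 0).comp
          continuous_subtype_val⟩
      map_add' := fun v w => by
        ext t
        exact intervalIntegral.integral_add ((v.continuous.Icc_extend').intervalIntegrable _ _)
          ((w.continuous.Icc_extend').intervalIntegrable _ _)
      map_smul' := fun r w => by
        ext t
        exact intervalIntegral.integral_smul r _ }
    (b - a) (fun w => by
      rw [ContinuousMap.norm_le _ (mul_nonneg (by linarith) (norm_nonneg _))]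
      intro t
      have h := intervalIntegral.norm_integral_le_of_norm_le_const (a := (0 : ℝ)) (b := t)
        (f := IccExtend (ha.trans hb) w) (C := ‖w‖) (fun s _ => w.norm_coe_le_norm _)
      refine h.trans ?_
      rw [mul_comm]
      gcongr
      have := t.2.1
      have := t.2.2
      rw [abs_le]; constructor <;> linarith)

theorem primitiveCLM_apply (ha : a ≤ 0) (hb : 0 ≤ b) (w : C(Icc a b, E)) (t : Icc a b) :
    primitiveCLM ha hb w t = ∫ s in (0 : ℝ)..t, IccExtend (ha.trans hb) w s := rfl

/-- The factorial comes from integrating `|s|^n` once more at each iteration, as in Picard's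
estimate. -/
theorem norm_volterra_pow_apply_le (ha : a ≤ 0) (hb : 0 ≤ b) {A : C(Icc a b, E →L[ℝ] E)} {C : ℝ}
    (hC : 0 ≤ C) (hA : ∀ t, ‖A t‖ ≤ C) (n : ℕ) (v : C(Icc a b, E)) (t : Icc a b) :
    ‖(((primitiveCLM ha hb).comp (pointwiseApply A)) ^ n) v t‖
      ≤ (C * |(t : ℝ) - 0|) ^ n / n.factorial * ‖v‖ := by
  induction n generalizing t with
  | zero => simpa using v.norm_coe_le_norm t
  | succ n hn =>
    rw [pow_succ']
    change ‖primitiveCLM ha hb (pointwiseApply A _) t‖ ≤ _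
    rw [primitiveCLM_apply]
    calc
      _ ≤ ∫ s in uIoc 0 (t : ℝ), C ^ (n + 1) * |s - 0| ^ n / n.factorial * ‖v‖ := by
        rw [intervalIntegral.norm_intervalIntegral_eq]
        apply norm_integral_le_of_norm_le (Continuous.integrableOn_uIoc (by fun_prop))
        apply ae_restrict_mem measurableSet_uIoc |>.mono
        intro s hs
        have hs' : s ∈ Icc a b :=
          uIoc_subset_uIcc.trans (uIcc_subset_Icc ⟨ha, hb⟩ t.2) hs
        rw [IccExtend_of_mem _ _ hs', pointwiseApply_apply]
        refine ((A _).le_opNorm _).trans ?_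
        refine (mul_le_mul (hA _) (hn ⟨s, hs'⟩) (norm_nonneg _) hC).trans (le_of_eq ?_)
        rw [mul_pow]; ring
      _ ≤ _ := by
        apply le_of_abs_le
        rw [← intervalIntegral.abs_intervalIntegral_eq, intervalIntegral.integral_mul_const,
          intervalIntegral.integral_div, intervalIntegral.integral_const_mul, abs_mul, abs_div,
          abs_mul, intervalIntegral.abs_intervalIntegral_eq, integral_pow_abs_sub_uIoc, abs_div,
          abs_pow, abs_pow, abs_norm, abs_of_nonneg hC, abs_abs, mul_div, div_div, ← abs_mul,
          ← Nat.cast_succ, ← Nat.cast_mul, ← Nat.factorial_succ, Nat.abs_cast, ← mul_pow]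

/-- By the factorial bound some power `T ^ n` has norm less than 1, so `1 - T ^ n` is invertible; it
is the product of `1 - T` and a geometric sum which commutes with it, hence `1 - T` is invertible,
whatever the norm of `T`. -/
theorem isUnit_one_sub_volterra [CompleteSpace E] (ha : a ≤ 0) (hb : 0 ≤ b)
    (A : C(Icc a b, E →L[ℝ] E)) :
    IsUnit (1 - (primitiveCLM ha hb).comp (pointwiseApply A)) := by
  set T := (primitiveCLM ha hb).comp (pointwiseApply A)
  obtain ⟨n, hn⟩ := FloorSemiring.tendsto_pow_div_factorial_atTop (‖A‖ * (b - a))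
    |>.eventually (gt_mem_nhds zero_lt_one) |>.exists
  have hnorm : ‖T ^ n‖ < 1 := by
    refine lt_of_le_of_lt (ContinuousLinearMap.opNorm_le_bound _ ?_ fun v => ?_) hn
    · have : 0 ≤ b - a := by linarith
      positivity
    · rw [ContinuousMap.norm_le _ (by
        have : 0 ≤ b - a := by linarith
        positivity)]
      intro t
      refine (norm_volterra_pow_apply_le ha hb (norm_nonneg A) A.norm_coe_le_norm n v t).trans ?_
      have h1 := t.2.1
      have h2 := t.2.2
      have : |(t : ℝ) - 0| ≤ b - a := by rw [abs_le]; constructor <;> linarith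
      gcongr
  have h := isUnit_one_sub_of_norm_lt_one
    (R := C(Icc a b, E) →L[ℝ] C(Icc a b, E)) hnorm
  rw [← mul_neg_geom_sum] at h
  have hcomm : Commute (1 - T) (∑ i ∈ Finset.range n, T ^ i) :=
    ((Commute.one_left _).sub_left (Commute.sum_right _ _ _ fun i _ => (Commute.refl T).pow_right i))
  exact (hcomm.isUnit_mul_iff.mp h).1

end Volterra

/-! ### Differentiable dependence on initial data -/

section Flow

open Filter Topology

variable {E : Type*} [NormedAddCommGroup E] [NormedSpace ℝ E] [FiniteDimensional ℝ E]

theorem contDiffOn_one_of_partial {E₁ E₂ F : Type*} [NormedAddCommGroup E₁] [NormedSpace ℝ E₁]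
    [NormedAddCommGroup E₂] [NormedSpace ℝ E₂] [NormedAddCommGroup F] [NormedSpace ℝ F]
    {S : Set (E₁ × E₂)} (hS : IsOpen S) {f : E₁ → E₂ → F} {f₁ : E₁ → E₂ → E₁ →L[ℝ] F}
    {f₂ : E₁ → E₂ → E₂ →L[ℝ] F}
    (hd₁ : ∀ q ∈ S, HasFDerivAt (fun t => f t q.2) (f₁ q.1 q.2) q.1)
    (hd₂ : ∀ q ∈ S, HasFDerivAt (fun x => f q.1 x) (f₂ q.1 q.2) q.2)
    (hc₁ : ContinuousOn (fun q : E₁ × E₂ => f₁ q.1 q.2) S)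
    (hc₂ : ContinuousOn (fun q : E₁ × E₂ => f₂ q.1 q.2) S) :
    ContDiffOn ℝ 1 (fun q : E₁ × E₂ => f q.1 q.2) S := by
  intro p hp
  refine (contDiffAt_one_iff.mpr ⟨fun q => (f₁ q.1 q.2).coprod (f₂ q.1 q.2), S,
    hS.mem_nhds hp, ?_, fun q hq => ?_⟩).contDiffWithinAt
  · have := (hc₁.clm_comp continuousOn_const (f := fun _ => ContinuousLinearMap.fst ℝ E₁ E₂)).add
      (hc₂.clm_comp continuousOn_const (f := fun _ => ContinuousLinearMap.snd ℝ E₁ E₂))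
    refine this.congr fun q _ => ?_
    ext <;> simp
  · exact (hasStrictFDerivAt_uncurry_coprod (f := f) (f₁ := f₁) (f₂ := f₂)
      (by filter_upwards [hS.mem_nhds hq] with v hv using hd₁ v hv)
      (by filter_upwards [hS.mem_nhds hq] with v hv using hd₂ v hv)
      (hc₁.continuousAt (hS.mem_nhds hq)) (hc₂.continuousAt (hS.mem_nhds hq))).hasFDerivAt

/-- The implicit function theorem in `C([a, b], E)`, at the given trajectory `γ`, solves the
integral equation for all initial points near `γ 0`, on the whole interval at once. -/
theorem exists_contDiffOn_flow {X : E → E} (hX : ContDiff ℝ 1 X) {a b : ℝ} (ha : a < 0)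
    (hb : 0 < b) {γ : ℝ → E} (hγ : ∀ t ∈ Icc a b, HasDerivWithinAt γ (X (γ t)) (Icc a b) t) :
    ∃ W : Set E, IsOpen W ∧ γ 0 ∈ W ∧ ∃ φ : ℝ → E → E,
      (∀ t ∈ Icc a b, φ t (γ 0) = γ t) ∧ (∀ x ∈ W, φ 0 x = x) ∧
      (∀ x ∈ W, ∀ t ∈ Ioo a b, HasDerivAt (fun s => φ s x) (X (φ t x)) t) ∧
      ContDiffOn ℝ 1 (fun p : ℝ × E => φ p.1 p.2) (Ioo a b ×ˢ W) := by
  have : CompleteSpace E := FiniteDimensional.complete ℝ E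
  have hab : a ≤ b := (ha.trans hb).le
  let N : C(Icc a b, E) → C(Icc a b, E) := fun u => (⟨X, hX.continuous⟩ : C(E, E)).comp u
  have hN : ContDiff ℝ 1 N := contDiff_postcomp hX
  let J : C(Icc a b, E) →L[ℝ] C(Icc a b, E) := primitiveCLM ha.le hb.le
  let cst : E →L[ℝ] C(Icc a b, E) := ContinuousLinearMap.const ℝ (Icc a b)
  let f : E × C(Icc a b, E) → C(Icc a b, E) := fun p => p.2 - cst p.1 - J (N p.2)
  have hf : ContDiff ℝ 1 f :=
    (contDiff_snd.sub (cst.contDiff.comp contDiff_fst)).sub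
      (J.contDiff.comp (hN.comp contDiff_snd))
  have hγc : ContinuousOn γ (Icc a b) := fun t ht => (hγ t ht).continuousWithinAt
  let u₀ : C(Icc a b, E) := ⟨(Icc a b).domRestrict γ, hγc.domRestrict⟩
  let p₀ : E × C(Icc a b, E) := (γ 0, u₀)
  have h0 : (0 : ℝ) ∈ Icc a b := ⟨ha.le, hb.le⟩
  have hf0 : f p₀ = 0 := by
    ext t
    have hint : ∫ s in (0 : ℝ)..t, IccExtend hab (N u₀) s = γ t - γ 0 := by
      have hsub : uIcc 0 (t : ℝ) ⊆ Icc a b := uIcc_subset_Icc h0 t.2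
      refine intervalIntegral.integral_eq_sub_of_hasDeriv_right (hγc.mono hsub) ?_
        ((N u₀).continuous.Icc_extend'.intervalIntegrable _ _)
      intro s hs
      have hs' : s ∈ Icc a b := hsub (Ioo_subset_Icc_self hs)
      rw [IccExtend_of_mem _ _ hs']
      refine (hγ s hs').mono_of_mem_nhdsWithin ?_
      have hsb : s < b := hs.2.trans_le (max_le hb.le t.2.2)
      exact mem_of_superset (Ioo_mem_nhdsGT hsb) fun x hx => ⟨hs'.1.trans hx.1.le, hx.2.le⟩
    change γ t - γ 0 - ∫ s in (0 : ℝ)..t, IccExtend hab (N u₀) s = 0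
    rw [hint, sub_self]
  -- The partial derivative in `u` is `1 - J ∘ A`, where `A` is multiplication by `DX` along `γ`: a
  -- Volterra operator.
  have hpart : (fderiv ℝ f p₀ ∘L .inr ℝ E C(Icc a b, E)).IsInvertible := by
    set A : C(Icc a b, E →L[ℝ] E) :=
      (⟨fderiv ℝ X, hX.continuous_fderiv one_ne_zero⟩ : C(E, E →L[ℝ] E)).comp u₀
    have h1 : HasFDerivAt (fun u => f (γ 0, u)) (1 - J.comp (pointwiseApply A)) u₀ :=
      ((hasFDerivAt_id u₀).sub_const (cst (γ 0))).fun_sub (J.hasFDerivAt.comp u₀ (hasFDerivAt_postcomp hX u₀))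
    have h2 : HasFDerivAt (fun u => f (γ 0, u)) (fderiv ℝ f p₀ ∘L .inr ℝ E C(Icc a b, E)) u₀ :=
      ((hf.differentiable one_ne_zero).differentiableAt (x := p₀)).hasFDerivAt.comp u₀
        (hasFDerivAt_prodMk_right (γ 0) u₀)
    rw [h2.unique h1]
    obtain ⟨w, hw⟩ := isUnit_one_sub_volterra ha.le hb.le A
    exact ⟨ContinuousLinearEquiv.unitsEquiv ℝ _ w, hw⟩
  have cdf : ContDiffAt ℝ 1 f p₀ := hf.contDiffAt
  let ψ : E → C(Icc a b, E) := cdf.implicitFunction one_ne_zero hpart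
  have hψ0 : ψ (γ 0) = u₀ := cdf.implicitFunction_apply_self one_ne_zero hpart
  have hψ : ∀ᶠ x in 𝓝 (γ 0), f (x, ψ x) = 0 := by
    have := cdf.eventually_apply_implicitFunction one_ne_zero hpart
    rwa [hf0] at this
  have hψC : ∀ᶠ x in 𝓝 (γ 0), ContDiffAt ℝ 1 ψ x :=
    (cdf.contDiffAt_implicitFunction one_ne_zero hpart).eventually (by simp)
  obtain ⟨W, hWsub, hWo, hW0⟩ := eventually_nhds_iff.mp (hψ.and hψC)
  have heq : ∀ x ∈ W, ∀ t ∈ Icc a b, IccExtend hab (ψ x) t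
      = x + ∫ s in (0 : ℝ)..t, X (IccExtend hab (ψ x) s) := by
    intro x hx t ht
    have h := congrArg (fun g : C(Icc a b, E) => g ⟨t, ht⟩) (hWsub x hx).1
    change ψ x ⟨t, ht⟩ - x - ∫ s in (0 : ℝ)..t, X (IccExtend hab (ψ x) s) = 0 at h
    rw [IccExtend_of_mem _ _ ht]
    rw [sub_sub, sub_eq_zero] at h
    exact h
  have hcontX : ∀ x, Continuous fun s => X (IccExtend hab (ψ x) s) := fun x =>
    hX.continuous.comp (ψ x).continuous.Icc_extend'
  have hderiv : ∀ x ∈ W, ∀ t ∈ Ioo a b,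
      HasDerivAt (fun s => IccExtend hab (ψ x) s) (X (IccExtend hab (ψ x) t)) t := by
    intro x hx t ht
    have h := (intervalIntegral.integral_hasDerivAt_right ((hcontX x).intervalIntegrable 0 t)
      ((hcontX x).stronglyMeasurableAtFilter _ _) (hcontX x).continuousAt).const_add x
    refine h.congr_of_eventuallyEq ?_
    filter_upwards [Icc_mem_nhds ht.1 ht.2] with s hs using heq x hx s hs
  refine ⟨W, hWo, hW0, fun t x => IccExtend hab (ψ x) t, ?_, ?_, ?_, ?_⟩
  · intro t ht
    simp only [hψ0, IccExtend_of_mem _ _ ht]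
    rfl
  · intro x hx
    simpa using heq x hx 0 h0
  · intro x hx t ht
    exact hderiv x hx t ht
  · intro p hp
    -- Joint regularity: the derivative in `t` is given by the differential equation, the one in `x`
    -- by evaluating the derivative of `ψ` at `t`; both are jointly continuous.
    let f₁ : ℝ → E → ℝ →L[ℝ] E := fun t x =>
      ContinuousLinearMap.toSpanSingleton ℝ (X (IccExtend hab (ψ x) t))
    let f₂ : ℝ → E → E →L[ℝ] E := fun t x =>
      (ContinuousMap.evalCLM ℝ (projIcc a b hab t)).comp (fderiv ℝ ψ x)
    have hψo : ContDiffOn ℝ 1 ψ W := fun x hx => (hWsub x hx).2.contDiffWithinAt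
    have hproj : Continuous fun q : ℝ × E => projIcc a b hab q.1 :=
      continuous_projIcc.comp continuous_fst
    have hc₁ : ContinuousOn (fun q : ℝ × E => f₁ q.1 q.2) (Ioo a b ×ˢ W) := by
      have h1 : ContinuousOn (fun q : ℝ × E => ψ q.2 (projIcc a b hab q.1)) (Ioo a b ×ˢ W) :=
        (hψo.continuousOn.comp continuousOn_snd fun q hq => hq.2).eval hproj.continuousOn
      exact (ContinuousLinearMap.toSpanSingletonCLE (𝕜 := ℝ) (E := E)).continuous.comp_continuousOn
        (hX.continuous.comp_continuousOn h1)
    have hc₂ : ContinuousOn (fun q : ℝ × E => f₂ q.1 q.2) (Ioo a b ×ˢ W) := by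
      rw [continuousOn_clm_apply]
      intro y
      have h2 : ContinuousOn (fun q : ℝ × E => fderiv ℝ ψ q.2 y) (Ioo a b ×ˢ W) :=
        ((hψo.continuousOn_fderiv_of_isOpen hWo le_rfl).comp continuousOn_snd
          fun q hq => hq.2).clm_apply continuousOn_const
      exact h2.eval hproj.continuousOn
    have hd₁ : ∀ q ∈ Ioo a b ×ˢ W,
        HasFDerivAt (fun t => IccExtend hab (ψ q.2) t) (f₁ q.1 q.2) q.1 :=
      fun q hq => (hderiv q.2 hq.2 q.1 hq.1).hasFDerivAt
    have hd₂ : ∀ q ∈ Ioo a b ×ˢ W,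
        HasFDerivAt (fun x => IccExtend hab (ψ x) q.1) (f₂ q.1 q.2) q.2 := fun q hq =>
      ((ContinuousMap.evalCLM ℝ (projIcc a b hab q.1) :
        C(Icc a b, E) →L[ℝ] E).hasFDerivAt (x := ψ q.2)).comp q.2
        ((hWsub q.2 hq.2).2.differentiableAt one_ne_zero).hasFDerivAt
    have hS : IsOpen (Ioo a b ×ˢ W) := isOpen_Ioo.prod hWo
    exact (contDiffOn_one_of_partial hS (f := fun t x => IccExtend hab (ψ x) t)
      hd₁ hd₂ hc₁ hc₂) p hp

end Flow

end RotatingCentres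

end

/-! ### Potential, force, and a vector field without singularities -/

open Set

noncomputable section

namespace RotatingCentres

variable {N : ℕ}

/-- `ν² |z|² / 2 + ∑ m_k / (α |z - a_k|^α)`, with arbitrary centres `a_k`. -/
def centredPotential (α : ℝ) (m : Fin N → ℝ) (a : Fin N → ℂ) (ν : ℝ) (z : ℂ) : ℝ :=
  ν ^ 2 / 2 * ‖z‖ ^ 2 + ∑ k, m k / (α * ‖z - a k‖ ^ α)

/-- The gradient of `centredPotential`. -/
def centredForce (α : ℝ) (m : Fin N → ℝ) (a : Fin N → ℂ) (ν : ℝ) (z : ℂ) : ℂ :=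
  ν ^ 2 • z - ∑ k, (m k * (‖z - a k‖ ^ 2) ^ (-(α + 2) / 2)) • (z - a k)

theorem effectivePotential_eq (α : ℝ) (m : Fin N → ℝ) (c : Fin N → ℂ) (ε ν : ℝ) :
    effectivePotential α m c ε ν = centredPotential α m (scaledCentres ε c) ν := rfl

theorem hasFDerivAt_centredPotential {α : ℝ} (hα : 0 < α) (m : Fin N → ℝ) {a : Fin N → ℂ} (ν : ℝ)
    {z : ℂ} (hz : ∀ k, z ≠ a k) :
    HasFDerivAt (centredPotential α m a ν) (innerSL ℝ (centredForce α m a ν z)) z := by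
  have h1 : HasFDerivAt (fun z : ℂ => ν ^ 2 / 2 * ‖z‖ ^ 2) (innerSL ℝ (ν ^ 2 • z)) z := by
    have := ((hasStrictFDerivAt_norm_sq z).hasFDerivAt).const_mul (ν ^ 2 / 2)
    refine this.congr_fderiv ?_
    ext w
    simp only [smul_apply, innerSL_apply_apply, real_inner_smul_left,
      smul_eq_mul, nsmul_eq_mul]
    push_cast; ring
  have h2 : ∀ k ∈ (Finset.univ : Finset (Fin N)),
      HasFDerivAt (fun z : ℂ => m k / (α * ‖z - a k‖ ^ α))
        (innerSL ℝ (-((m k * (‖z - a k‖ ^ 2) ^ (-(α + 2) / 2)) • (z - a k)))) z := by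
    intro k _
    have hne : ‖z - a k‖ ^ 2 ≠ 0 := pow_ne_zero _ (norm_ne_zero_iff.mpr (sub_ne_zero.mpr (hz k)))
    -- The potential is written as a power of the squared norm, which is differentiable everywhere.
    have heq : (fun z : ℂ => m k / (α * ‖z - a k‖ ^ α))
        = fun z : ℂ => m k / α * (‖z - a k‖ ^ 2) ^ (-α / 2) := by
      funext w
      rw [← Real.rpow_natCast_mul (norm_nonneg _), div_mul_eq_div_div, div_eq_mul_inv (m k / α),
        ← Real.rpow_neg (norm_nonneg _)]
      congr 2
      push_cast; ring
    rw [heq]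
    have hsq : HasFDerivAt (fun z : ℂ => ‖z - a k‖ ^ 2) (2 • innerSL ℝ (z - a k)) z := by
      have := ((hasStrictFDerivAt_norm_sq (z - a k)).hasFDerivAt).comp z
        ((hasFDerivAt_id z).sub_const (a k))
      exact this
    have := ((Real.hasDerivAt_rpow_const (p := -α / 2) (Or.inl hne)).comp_hasFDerivAt z
      hsq).const_mul (m k / α)
    refine this.congr_fderiv ?_
    have hp : -α / 2 - 1 = -(α + 2) / 2 := by ring
    have hα' := hα.ne'
    ext w
    simp only [smul_apply, innerSL_apply_apply, real_inner_smul_left,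
      smul_eq_mul, nsmul_eq_mul, inner_neg_left, hp]
    push_cast; field_simp
  have h3 := h1.add (HasFDerivAt.fun_sum h2)
  have heq : centredForce α m a ν z = ν ^ 2 • z
      + ∑ k, -((m k * (‖z - a k‖ ^ 2) ^ (-(α + 2) / 2)) • (z - a k)) := by
    rw [Finset.sum_neg_distrib, ← sub_eq_add_neg]; rfl
  refine h3.congr_fderiv ?_
  rw [heq, map_add, map_sum]

theorem gradient_centredPotential {α : ℝ} (hα : 0 < α) (m : Fin N → ℝ) {a : Fin N → ℂ} (ν : ℝ)
    {z : ℂ} (hz : ∀ k, z ≠ a k) :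
    gradient (centredPotential α m a ν) z = centredForce α m a ν z :=
  HasGradientAt.gradient (hasFDerivAt_centredPotential hα m ν hz)

theorem centredPotential_rotate (α : ℝ) (m : Fin N → ℝ) (a : Fin N → ℂ) (ν : ℝ) (z : ℂ) {u : ℂ}
    (hu : ‖u‖ = 1) :
    centredPotential α m (fun k => u * a k) ν (u * z) = centredPotential α m a ν z := by
  simp [centredPotential, ← mul_sub, hu]

theorem centredForce_rotate (α : ℝ) (m : Fin N → ℝ) (a : Fin N → ℂ) (ν : ℝ) (z : ℂ) {u : ℂ}
    (hu : ‖u‖ = 1) :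
    centredForce α m (fun k => u * a k) ν (u * z) = u * centredForce α m a ν z := by
  simp only [centredForce, ← mul_sub, norm_mul, hu, one_mul]
  rw [mul_sub, Finset.mul_sum, mul_smul_comm]
  simp only [mul_smul_comm]

/-- `(z, v)` solves, on `J`, the equations of motion with centres `a_k` and angular velocity `ν`. -/
def SolvesOn (α : ℝ) (m : Fin N → ℝ) (a : Fin N → ℂ) (ν : ℝ) (z v : ℝ → ℂ) (J : Set ℝ) : Prop :=
  ∀ t ∈ J, HasDerivWithinAt z (v t) J t ∧
    HasDerivWithinAt v (centredForce α m a ν (z t) - 2 * (ν : ℂ) * Complex.I * v t) J t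

theorem SolvesOn.mono {α : ℝ} {m : Fin N → ℝ} {a : Fin N → ℂ} {ν : ℝ} {z v : ℝ → ℂ} {J J' : Set ℝ}
    (h : SolvesOn α m a ν z v J) (hJ : J' ⊆ J) : SolvesOn α m a ν z v J' :=
  fun t ht => ⟨(h t (hJ ht)).1.mono hJ, (h t (hJ ht)).2.mono hJ⟩

theorem SolvesOn.rotate {α : ℝ} {m : Fin N → ℝ} {a : Fin N → ℂ} {ν : ℝ} {z v : ℝ → ℂ} {J : Set ℝ}
    (h : SolvesOn α m a ν z v J) {u : ℂ} (hu : ‖u‖ = 1) :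
    SolvesOn α m (fun k => u * a k) ν (fun t => u * z t) (fun t => u * v t) J := by
  intro t ht
  refine ⟨(h t ht).1.const_mul u, ?_⟩
  rw [centredForce_rotate α m a ν (z t) hu]
  refine ((h t ht).2.const_mul u).congr_deriv ?_
  ring

/-- The Coriolis term is orthogonal to the velocity and does no work. -/
theorem SolvesOn.energy_eq {α : ℝ} (hα : 0 < α) {m : Fin N → ℝ} {a : Fin N → ℂ} {ν : ℝ}
    {z v : ℝ → ℂ} {S : ℝ} (h : SolvesOn α m a ν z v (Icc 0 S))
    (hz : ∀ t ∈ Icc 0 S, ∀ k, z t ≠ a k) {t : ℝ} (ht : t ∈ Icc 0 S) :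
    1 / 2 * ‖v t‖ ^ 2 - centredPotential α m a ν (z t)
      = 1 / 2 * ‖v 0‖ ^ 2 - centredPotential α m a ν (z 0) := by
  have hd : ∀ s ∈ Icc 0 S, HasDerivWithinAt
      (fun s => 1 / 2 * ‖v s‖ ^ 2 - centredPotential α m a ν (z s)) 0 (Icc 0 S) s := by
    intro s hs
    have h1 := ((h s hs).2.norm_sq).const_mul (1 / 2 : ℝ)
    have h2 := (hasFDerivAt_centredPotential hα m ν (hz s hs)).comp_hasDerivWithinAt s (h s hs).1
    refine (h1.sub h2).congr_deriv ?_
    simp only [innerSL_apply_apply, Complex.inner, Complex.mul_re, Complex.conj_re, Complex.conj_im,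
      Complex.sub_re, Complex.sub_im, Complex.mul_im, Complex.I_re, Complex.I_im,
      Complex.ofReal_re, Complex.ofReal_im, Complex.re_ofNat, Complex.im_ofNat]
    ring
  exact constant_of_derivWithin_zero (fun s hs => (hd s hs).differentiableWithinAt)
    (fun s hs => (hd s (Ico_subset_Icc_self hs)).derivWithin
      (uniqueDiffOn_Icc (hs.1.trans_lt hs.2) s (Ico_subset_Icc_self hs))) t ht

/-- A `C¹` function on `ℝ` which is `s ^ p` for `s ≥ s₀`. -/
def powCutoff (p s₀ s : ℝ) : ℝ := Real.smoothTransition (2 * s / s₀ - 1) * s ^ p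

theorem powCutoff_of_le (p : ℝ) {s₀ s : ℝ} (h₀ : 0 < s₀) (h : s₀ ≤ s) : powCutoff p s₀ s = s ^ p := by
  rw [powCutoff, Real.smoothTransition.one_of_one_le, one_mul]
  rw [le_sub_iff_add_le, le_div_iff₀ h₀]
  linarith

/-- The cutoff factor vanishes for `s ≤ s₀ / 2`, so the singularity of the power at `0` is never
met. -/
theorem contDiff_powCutoff (p : ℝ) {s₀ : ℝ} (h₀ : 0 < s₀) : ContDiff ℝ 1 (powCutoff p s₀) := by
  rw [contDiff_iff_contDiffAt]
  intro s
  rcases lt_or_ge s (s₀ / 2) with hs | hs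
  · refine (contDiffAt_const (c := (0 : ℝ))).congr_of_eventuallyEq ?_
    filter_upwards [Iio_mem_nhds hs] with x hx
    rw [powCutoff, Real.smoothTransition.zero_of_nonpos, zero_mul]
    rw [sub_nonpos, div_le_one h₀]
    have : x < s₀ / 2 := hx
    linarith
  · have h1 : ContDiff ℝ 1 fun s => Real.smoothTransition (2 * s / s₀ - 1) :=
      Real.smoothTransition.contDiff.comp (by fun_prop)
    exact h1.contDiffAt.mul (Real.contDiffAt_rpow_const_of_ne (by linarith))

/-- The vector field of the equations of motion on the space of `(z, v, a, ν)`, made `C¹` near the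
collisions. -/
def cutoffField (α : ℝ) (m : Fin N → ℝ) (s₀ : ℝ) (x : ℂ × ℂ × (Fin N → ℂ) × ℝ) :
    ℂ × ℂ × (Fin N → ℂ) × ℝ :=
  (x.2.1, x.2.2.2 ^ 2 • x.1
    - ∑ k, (m k * powCutoff (-(α + 2) / 2) s₀ (‖x.1 - x.2.2.1 k‖ ^ 2)) • (x.1 - x.2.2.1 k)
    - 2 * (x.2.2.2 : ℂ) * Complex.I * x.2.1, 0, 0)

theorem contDiff_cutoffField (α : ℝ) (m : Fin N → ℝ) {s₀ : ℝ} (h₀ : 0 < s₀) :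
    ContDiff ℝ 1 (cutoffField α m s₀) := by
  have hp := contDiff_powCutoff (-(α + 2) / 2) h₀
  have h1 : ∀ k, ContDiff ℝ 1 fun x : ℂ × ℂ × (Fin N → ℂ) × ℝ => x.1 - x.2.2.1 k := by
    intro k; fun_prop
  have h2 : ∀ k, ContDiff ℝ 1 fun x : ℂ × ℂ × (Fin N → ℂ) × ℝ =>
      (m k * powCutoff (-(α + 2) / 2) s₀ (‖x.1 - x.2.2.1 k‖ ^ 2)) • (x.1 - x.2.2.1 k) := fun k =>
    (contDiff_const.mul (hp.comp ((h1 k).norm_sq ℝ))).smul (h1 k)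
  have h3 : ContDiff ℝ 1 fun x : ℂ × ℂ × (Fin N → ℂ) × ℝ => (x.2.2.2 : ℂ) :=
    Complex.ofRealCLM.contDiff.comp (by fun_prop)
  have h4 : ContDiff ℝ 1 fun x : ℂ × ℂ × (Fin N → ℂ) × ℝ => x.2.2.2 ^ 2 • x.1 := by fun_prop
  exact ContDiff.prodMk (by fun_prop) (ContDiff.prodMk
    ((h4.sub (ContDiff.sum fun k _ => h2 k)).sub (((contDiff_const.mul h3).mul contDiff_const).mul
      (by fun_prop))) contDiff_const)

theorem cutoffField_eq {α : ℝ} {m : Fin N → ℝ} {s₀ : ℝ} (h₀ : 0 < s₀) {z v : ℂ} {a : Fin N → ℂ}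
    {ν : ℝ} (h : ∀ k, s₀ ≤ ‖z - a k‖ ^ 2) :
    cutoffField α m s₀ (z, v, a, ν)
      = (v, centredForce α m a ν z - 2 * (ν : ℂ) * Complex.I * v, 0, 0) := by
  simp only [cutoffField, centredForce, powCutoff_of_le _ h₀ (h _)]

theorem SolvesOn.hasDerivWithinAt {α : ℝ} {m : Fin N → ℝ} {a : Fin N → ℂ} {ν : ℝ} {z v : ℝ → ℂ}
    {J : Set ℝ} (h : SolvesOn α m a ν z v J) {s₀ : ℝ} (h₀ : 0 < s₀) {t : ℝ} (ht : t ∈ J)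
    (hz : ∀ k, s₀ ≤ ‖z t - a k‖ ^ 2) :
    HasDerivWithinAt (fun t => (z t, v t, a, ν)) (cutoffField α m s₀ (z t, v t, a, ν)) J t := by
  rw [cutoffField_eq h₀ hz]
  exact (h t ht).1.prodMk ((h t ht).2.prodMk
    ((hasDerivWithinAt_const t J a).prodMk (hasDerivWithinAt_const t J ν)))

theorem sq_le_norm_sub_sq {r : ℝ} (hr : 0 ≤ r) {z : ℂ} {a : Fin N → ℂ} (ha : ‖a‖ ≤ r)
    (hz : 2 * r ≤ ‖z‖) (k : Fin N) : r ^ 2 ≤ ‖z - a k‖ ^ 2 := by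
  have h1 := norm_le_pi_norm a k
  have h2 := norm_sub_norm_le z (a k)
  exact pow_le_pow_left₀ hr (by linarith) 2

/-- The field is Lipschitz on the compact union of the two trajectories, which is all that
Grönwall's uniqueness argument needs. -/
theorem eqOn_Icc_of_hasDerivWithinAt {E : Type*} [NormedAddCommGroup E] [NormedSpace ℝ E]
    {X : E → E} (hX : ContDiff ℝ 1 X) {L : ℝ} {f g : ℝ → E}
    (hf : ∀ t ∈ Icc 0 L, HasDerivWithinAt f (X (f t)) (Icc 0 L) t)
    (hg : ∀ t ∈ Icc 0 L, HasDerivWithinAt g (X (g t)) (Icc 0 L) t) (h : f 0 = g 0) :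
    EqOn f g (Icc 0 L) := by
  have hfc : ContinuousOn f (Icc 0 L) := fun t ht => (hf t ht).continuousWithinAt
  have hgc : ContinuousOn g (Icc 0 L) := fun t ht => (hg t ht).continuousWithinAt
  obtain ⟨C, hC⟩ := LocallyLipschitzOn.exists_lipschitzOnWith_of_compact
    ((isCompact_Icc.image_of_continuousOn hfc).union (isCompact_Icc.image_of_continuousOn hgc))
    (hX.locallyLipschitz.locallyLipschitzOn)
  have hright : ∀ {w : ℝ → E} {w' : E} {t : ℝ}, t ∈ Ico 0 L →
      HasDerivWithinAt w w' (Icc 0 L) t → HasDerivWithinAt w w' (Ici t) t := by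
    intro w w' t ht hw
    refine hw.mono_of_mem_nhdsWithin ?_
    exact Filter.mem_of_superset (Icc_mem_nhdsGE ht.2) (Icc_subset_Icc_left ht.1)
  exact ODE_solution_unique_of_mem_Icc_right (v := fun _ => X)
    (s := fun _ => f '' Icc 0 L ∪ g '' Icc 0 L) (fun t _ => hC)
    hfc (fun t ht => hright ht (hf t (Ico_subset_Icc_self ht)))
    (fun t ht => Or.inl (mem_image_of_mem f (Ico_subset_Icc_self ht)))
    hgc (fun t ht => hright ht (hg t (Ico_subset_Icc_self ht)))
    (fun t ht => Or.inr (mem_image_of_mem g (Ico_subset_Icc_self ht))) h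

/-- Both curves keep a distance at least `r` from every centre, so they solve the equation of the
cut-off field with `s₀ = r²`, which is `C¹`. -/
theorem SolvesOn.eqOn {α : ℝ} {m : Fin N → ℝ} {a : Fin N → ℂ} {ν : ℝ} {z v z' v' : ℝ → ℂ}
    {L r : ℝ} (hr : 0 < r) (ha : ‖a‖ ≤ r) (h : SolvesOn α m a ν z v (Icc 0 L))
    (h' : SolvesOn α m a ν z' v' (Icc 0 L)) (hz : ∀ t ∈ Icc 0 L, 2 * r ≤ ‖z t‖)
    (hz' : ∀ t ∈ Icc 0 L, 2 * r ≤ ‖z' t‖) (h0 : z 0 = z' 0) (hv0 : v 0 = v' 0) :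
    ∀ t ∈ Icc 0 L, z t = z' t ∧ v t = v' t := by
  have hr2 : 0 < r ^ 2 := by positivity
  have := eqOn_Icc_of_hasDerivWithinAt (contDiff_cutoffField α m hr2) (L := L)
    (f := fun t => (z t, v t, a, ν)) (g := fun t => (z' t, v' t, a, ν))
    (fun t ht => h.hasDerivWithinAt hr2 ht fun k => sq_le_norm_sub_sq hr.le ha (hz t ht) k)
    (fun t ht => h'.hasDerivWithinAt hr2 ht fun k => sq_le_norm_sub_sq hr.le ha (hz' t ht) k)
    (by simp [h0, hv0])
  intro t ht
  have := this ht
  simp only [Prod.mk.injEq] at this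
  exact ⟨this.1, this.2.1⟩

end RotatingCentres

end

/-! ### The radial Kepler orbit -/

open Set

noncomputable section

namespace RotatingCentres

open Filter Topology

/-- A solution of speed at most `L` stays in the ball of radius `L B` during the time `B`; this ball
is compact, so one Lipschitz constant serves on it and Picard–Lindelöf gives the full interval. -/
theorem exists_hasDerivWithinAt_of_bounded {E : Type*} [NormedAddCommGroup E] [NormedSpace ℝ E]
    [FiniteDimensional ℝ E] {X : E → E} (hX : LocallyLipschitz X) {L : ℝ} (hL : ∀ x, ‖X x‖ ≤ L)
    (x₀ : E) {B : ℝ} (hB : 0 ≤ B) :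
    ∃ γ : ℝ → E, γ 0 = x₀ ∧
      ∀ t ∈ Icc (-B) B, HasDerivWithinAt γ (X (γ t)) (Icc (-B) B) t := by
  have : CompleteSpace E := FiniteDimensional.complete ℝ E
  have : ProperSpace E := FiniteDimensional.proper ℝ E
  have hL0 : 0 ≤ L := (norm_nonneg _).trans (hL x₀)
  lift L to NNReal using hL0
  lift B to NNReal using hB
  obtain ⟨K, hK⟩ := LocallyLipschitzOn.exists_lipschitzOnWith_of_compact
    (isCompact_closedBall x₀ (L * B : NNReal)) hX.locallyLipschitzOn
  have hpl : IsPicardLindelof (fun _ => X) (tmin := -(B : ℝ)) (tmax := B)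
      ⟨0, by simp⟩ x₀ (L * B) 0 L K :=
    { lipschitzOnWith := fun _ _ => hK
      continuousOn := fun _ _ => continuousOn_const
      norm_le := fun _ _ x _ => hL x
      mul_max_le := by simp }
  exact hpl.exists_eq_forall_mem_Icc_hasDerivWithinAt₀

theorem powCutoff_nonneg (p : ℝ) {s₀ s : ℝ} (h₀ : 0 < s₀) : 0 ≤ powCutoff p s₀ s := by
  rcases le_or_gt s 0 with hs | hs
  · rw [powCutoff, Real.smoothTransition.zero_of_nonpos, zero_mul]
    rw [sub_nonpos, div_le_one h₀]; linarith
  · exact mul_nonneg (Real.smoothTransition.nonneg _) (Real.rpow_nonneg hs.le _)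

theorem powCutoff_le {p : ℝ} (hp : p ≤ 0) {s₀ s : ℝ} (h₀ : 0 < s₀) :
    powCutoff p s₀ s ≤ (s₀ / 2) ^ p := by
  rcases le_or_gt s (s₀ / 2) with hs | hs
  · rw [powCutoff, Real.smoothTransition.zero_of_nonpos, zero_mul]
    · positivity
    · rw [sub_nonpos, div_le_one h₀]; linarith
  · have h1 : s ^ p ≤ (s₀ / 2) ^ p := Real.rpow_le_rpow_of_nonpos (by positivity) hs.le hp
    have h2 : 0 ≤ s ^ p := Real.rpow_nonneg (by linarith) _
    exact (mul_le_of_le_one_left h2 (Real.smoothTransition.le_one _)).trans h1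

/-- Rectilinear motion with acceleration `-M powCutoff p s₀ r` exists for all times. -/
theorem exists_rectilinear_motion {M p s₀ : ℝ} (hM : 0 ≤ M) (hp : p ≤ 0) (h₀ : 0 < s₀)
    (r₀ w₀ : ℝ) {B : ℝ} (hB : 0 ≤ B) :
    ∃ r w : ℝ → ℝ, r 0 = r₀ ∧ w 0 = w₀ ∧ ∀ t ∈ Icc (-B) B,
      HasDerivWithinAt r (w t) (Icc (-B) B) t ∧
      HasDerivWithinAt w (-(M * powCutoff p s₀ (r t))) (Icc (-B) B) t := by
  set G : ℝ := M * (s₀ / 2) ^ p with hG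
  have hG0 : 0 ≤ G := by positivity
  -- `G` bounds the force, so the velocity cannot exceed `C` up to the time `B`. Clipping the
  -- velocity at `C` makes the field bounded without changing the solution.
  set C : ℝ := |w₀| + G * B with hC
  have hC0 : 0 ≤ C := by positivity
  let clip : ℝ → ℝ := fun w => max (-C) (min w C)
  have hclip : LipschitzWith 1 clip := (LipschitzWith.id.min_const C).const_max (-C)
  have hg : ∀ x, |M * powCutoff p s₀ x| ≤ G := fun x => by
    rw [abs_of_nonneg (mul_nonneg hM (powCutoff_nonneg p h₀))]
    exact mul_le_mul_of_nonneg_left (powCutoff_le hp h₀) hM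
  let X : ℝ × ℝ → ℝ × ℝ := fun x => (clip x.2, -(M * powCutoff p s₀ x.1))
  have hX : LocallyLipschitz X := by
    refine LocallyLipschitz.prodMk (hclip.comp LipschitzWith.prod_snd).locallyLipschitz ?_
    exact ContDiff.locallyLipschitz (𝕂 := ℝ)
      (contDiff_const.mul ((contDiff_powCutoff p h₀).comp contDiff_fst)).neg
  have hb : ∀ x, ‖X x‖ ≤ max C G := fun x => by
    refine max_le_max ?_ ?_
    · rw [Real.norm_eq_abs, abs_le]
      exact ⟨le_max_left _ _, max_le (by linarith) (min_le_right _ _)⟩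
    · rw [norm_neg]; exact hg _
  obtain ⟨γ, hγ0, hγ⟩ := exists_hasDerivWithinAt_of_bounded hX hb (r₀, w₀) hB
  have h1 : ∀ t ∈ Icc (-B) B, HasDerivWithinAt (fun t => (γ t).1) (clip (γ t).2) (Icc (-B) B) t :=
    fun t ht => (hγ t ht).fst
  have h2 : ∀ t ∈ Icc (-B) B, HasDerivWithinAt (fun t => (γ t).2)
      (-(M * powCutoff p s₀ (γ t).1)) (Icc (-B) B) t :=
    fun t ht => (hγ t ht).snd
  refine ⟨fun t => (γ t).1, fun t => (γ t).2, by simp [hγ0], by simp [hγ0], fun t ht =>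
    ⟨?_, h2 t ht⟩⟩
  have h0 : (0 : ℝ) ∈ Icc (-B) B := ⟨by linarith, hB⟩
  have h3 := (convex_Icc (-B) B).norm_image_sub_le_of_norm_hasDerivWithin_le h2
    (fun s _ => by rw [norm_neg]; exact hg _) h0 ht
  simp only [hγ0, Real.norm_eq_abs, sub_zero] at h3
  have h4 : |(γ t).2| ≤ C := by
    have h5 : |t| ≤ B := abs_le.mpr ht
    have h6 := abs_sub_abs_le_abs_sub (γ t).2 w₀
    have h7 : G * |t| ≤ G * B := by gcongr
    linarith
  have h5 : clip (γ t).2 = (γ t).2 := by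
    obtain ⟨h6, h7⟩ := abs_le.mp h4
    simp only [clip]
    rw [min_eq_left h7, max_eq_right h6]
  have := h1 t ht
  rwa [h5] at this

theorem radial_energy {α M E L : ℝ} {r w : ℝ → ℝ} (hα : 0 < α)
    (h : ∀ t ∈ Icc 0 L, HasDerivWithinAt r (w t) (Icc 0 L) t ∧
      HasDerivWithinAt w (-(M * r t ^ (-(α + 1)))) (Icc 0 L) t)
    (hr : ∀ t ∈ Icc 0 L, 0 < r t) (h0 : 1 / 2 * w 0 ^ 2 - M / (α * r 0 ^ α) = E)
    {t : ℝ} (ht : t ∈ Icc 0 L) : 1 / 2 * w t ^ 2 - M / (α * r t ^ α) = E := by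
  have hd : ∀ s ∈ Icc 0 L, HasDerivWithinAt
      (fun s => 1 / 2 * w s ^ 2 - M / α * r s ^ (-α)) 0 (Icc 0 L) s := by
    intro s hs
    have h1 := ((h s hs).2.fun_pow 2).const_mul (1 / 2 : ℝ)
    have h2 := ((h s hs).1.rpow_const (p := -α) (Or.inl (hr s hs).ne')).const_mul (M / α)
    refine (h1.sub h2).congr_deriv ?_
    rw [show -α - 1 = -(α + 1) by ring]
    field_simp
    ring
  have heq : ∀ s ∈ Icc 0 L, M / (α * r s ^ α) = M / α * r s ^ (-α) := fun s hs => by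
    rw [Real.rpow_neg (hr s hs).le, ← div_eq_mul_inv, div_div]
  have hc := constant_of_derivWithin_zero (fun s hs => (hd s hs).differentiableWithinAt)
    (fun s hs => (hd s (Ico_subset_Icc_self hs)).derivWithin
      (uniqueDiffOn_Icc (hs.1.trans_lt hs.2) s (Ico_subset_Icc_self hs))) t ht
  rw [heq t ht, ← h0, heq 0 ⟨le_rfl, ht.1.trans ht.2⟩]
  exact hc

/-- At energy `-1` the kinetic term is nonnegative, which gives the hypothesis `h`; the conclusion
is the bound by the turning radius. -/
theorem le_of_one_le_div_mul_rpow {α M r : ℝ} (hα : 0 < α) (hr : 0 < r)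
    (h : 1 ≤ M / (α * r ^ α)) : r ≤ (M / α) ^ (1 / α) := by
  have h1 : 0 < r ^ α := Real.rpow_pos_of_pos hr α
  have h2 : r ^ α ≤ M / α := by
    rw [le_div_iff₀ (by positivity)] at h
    rw [le_div_iff₀ hα]; linarith
  calc r = (r ^ α) ^ (1 / α) := by
        rw [← Real.rpow_mul hr.le, mul_one_div_cancel hα.ne', Real.rpow_one]
    _ ≤ _ := Real.rpow_le_rpow h1.le h2 (by positivity)

/-- Comparison with uniformly decelerated motion; it forces the radial orbit to come back in finite
time. -/
theorem le_sub_mul_sq_of_accel_le {r w g : ℝ → ℝ} {κ L : ℝ}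
    (h : ∀ t ∈ Icc 0 L, HasDerivWithinAt r (w t) (Icc 0 L) t ∧
      HasDerivWithinAt w (-(g t)) (Icc 0 L) t)
    (hg : ∀ t ∈ Icc 0 L, κ ≤ g t) {t : ℝ} (ht : t ∈ Icc 0 L) :
    r t ≤ r 0 + w 0 * t - κ / 2 * t ^ 2 := by
  have h0 : (0 : ℝ) ∈ Icc 0 L := ⟨le_rfl, ht.1.trans ht.2⟩
  have hanti : ∀ {f f' : ℝ → ℝ}, (∀ t ∈ Icc 0 L, HasDerivWithinAt f (f' t) (Icc 0 L) t) →
      (∀ t ∈ Icc 0 L, f' t ≤ 0) → ∀ t ∈ Icc 0 L, f t ≤ f 0 := by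
    intro f f' hf hf' t ht
    refine antitoneOn_of_hasDerivWithinAt_nonpos (f' := f') (convex_Icc 0 L)
      (fun s hs => (hf s hs).continuousWithinAt) (fun s hs => ?_) (fun s hs => ?_) h0 ht ht.1
    · exact (hf s (interior_subset hs)).mono interior_subset
    · exact hf' s (interior_subset hs)
  have hw : ∀ t ∈ Icc 0 L, w t + κ * t ≤ w 0 + κ * 0 :=
    hanti (f := fun t => w t + κ * t) (f' := fun t => -(g t) + κ * 1)
      (fun t ht => (h t ht).2.add ((hasDerivWithinAt_id t _).const_mul κ))
      (fun t ht => by linarith [hg t ht])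
  have hr := hanti (f := fun t => r t - w 0 * t + κ / 2 * t ^ 2)
    (f' := fun t => w t - w 0 * 1 + κ / 2 * (2 * t))
    (fun t ht => ((h t ht).1.sub ((hasDerivWithinAt_id t _).const_mul (w 0))).add
      (by simpa using ((hasDerivWithinAt_id t _).fun_pow 2).const_mul (κ / 2)))
    (fun t ht => by linarith [hw t ht]) t ht
  simp at hr
  linarith

/-- The rectilinear solution of energy `-1` of the `α`-Kepler problem which leaves the circle of
radius `R` at the time `0` and comes back for the first time at the time `T₀`. -/
structure IsRadialOrbit (α M R : ℝ) (β T₀ : ℝ) (r w : ℝ → ℝ) : Prop where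
  margin_pos : 0 < β
  time_pos : 0 < T₀
  hasDeriv : ∀ t ∈ Icc (-β) (T₀ + β), HasDerivWithinAt r (w t) (Icc (-β) (T₀ + β)) t
  hasDeriv' : ∀ t ∈ Icc (-β) (T₀ + β),
    HasDerivWithinAt w (-(M * r t ^ (-(α + 1)))) (Icc (-β) (T₀ + β)) t
  start : r 0 = R
  start' : w 0 = √(2 * (-1 + M / (α * R ^ α)))
  half_lt : ∀ t ∈ Icc (-β) (T₀ + β), R / 2 < r t
  lt : ∀ t ∈ Ioo 0 T₀, R < r t
  finish : r T₀ = R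
  finish' : w T₀ < 0
  le : ∀ t ∈ Icc 0 T₀, r t ≤ (M / α) ^ (1 / α)
  abs_le : ∀ t ∈ Icc 0 T₀, |w t| ≤ √(2 * (-1 + M / (α * R ^ α)))

theorem exists_isRadialOrbit {α M R : ℝ} (hα : 0 < α) (hM : 0 < M) (hR : 0 < R)
    (hE : 1 < M / (α * R ^ α)) : ∃ (β T₀ : ℝ) (r w : ℝ → ℝ), IsRadialOrbit α M R β T₀ r w := by
  set w₀ : ℝ := √(2 * (-1 + M / (α * R ^ α))) with hw₀
  have hw₀sq : w₀ ^ 2 = 2 * (-1 + M / (α * R ^ α)) := Real.sq_sqrt (by linarith)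
  have hw₀pos : 0 < w₀ := Real.sqrt_pos.mpr (by linarith)
  set rmax : ℝ := (M / α) ^ (1 / α) with hrmax
  have hrmaxpos : 0 < rmax := by positivity
  -- The smallest attraction at radii up to `rmax`. With deceleration at least `κ` the orbit would
  -- be back at `R` by the time `2 w₀ / κ`; `B'` is one unit later, so that the comparison gives a
  -- strict contradiction.
  set κ : ℝ := M * rmax ^ (-(α + 1)) with hκ
  have hκpos : 0 < κ := by positivity
  set B' : ℝ := 2 * w₀ / κ + 1 with hB'
  have hB'pos : 0 < B' := by positivity
  set B : ℝ := B' + 1 with hB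
  have hp : -(α + 1) ≤ 0 := by linarith
  obtain ⟨r, w, hr0, hw0, hrw⟩ := exists_rectilinear_motion hM.le hp (half_pos hR) R w₀
    (B := B) (by linarith)
  have hI : ∀ {L}, L ≤ B → Icc 0 L ⊆ Icc (-B) B := fun hL => Icc_subset_Icc (by linarith) hL
  have hrc : ContinuousOn r (Icc (-B) B) := fun t ht => (hrw t ht).1.continuousWithinAt
  have hforce : ∀ t, R / 2 ≤ r t →
      -(M * powCutoff (-(α + 1)) (R / 2) (r t)) = -(M * r t ^ (-(α + 1))) := fun t ht => by
    rw [powCutoff_of_le _ (half_pos hR) ht]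
  have henergy : ∀ L ≤ B, (∀ t ∈ Icc 0 L, R ≤ r t) → ∀ t ∈ Icc 0 L,
      1 / 2 * w t ^ 2 - M / (α * r t ^ α) = -1 := by
    intro L hL hLr t ht
    refine radial_energy (L := L) hα (fun s hs => ?_) (fun s hs => hR.trans_le (hLr s hs)) ?_ ht
    · have := hrw s (hI hL hs)
      rw [hforce s (by linarith [hLr s hs])] at this
      exact ⟨this.1.mono (hI hL), this.2.mono (hI hL)⟩
    · rw [hr0, hw0, hw₀sq]; ring
  have hrle : ∀ L ≤ B, (∀ t ∈ Icc 0 L, R ≤ r t) → ∀ t ∈ Icc 0 L, r t ≤ rmax := by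
    intro L hL hLr t ht
    refine le_of_one_le_div_mul_rpow hα (hR.trans_le (hLr t ht)) ?_
    have := henergy L hL hLr t ht
    nlinarith [sq_nonneg (w t)]
  have hderat : ∀ t ∈ Ioo (-B) B, HasDerivAt r (w t) t := fun t ht =>
    (hrw t (Ioo_subset_Icc_self ht)).1.hasDerivAt (Icc_mem_nhds ht.1 ht.2)
  -- the orbit first leaves the disc
  obtain ⟨t₁, ht₁pos, ht₁⟩ : ∃ t₁ > 0, ∀ t ∈ Ioo 0 t₁, R < r t := by
    have h1 : HasDerivAt r w₀ 0 := hw0 ▸ hderat 0 ⟨by linarith, by linarith⟩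
    have h2 := (hasDerivAt_iff_tendsto_slope.mp h1).eventually (lt_mem_nhds hw₀pos)
    have h3 : ∀ᶠ t in 𝓝[>] (0 : ℝ), R < r t := by
      filter_upwards [nhdsWithin_mono 0 (fun x (hx : x ∈ Ioi (0 : ℝ)) => ne_of_gt hx) h2,
        self_mem_nhdsWithin] with t ht ht0
      have ht0' : (0 : ℝ) < t := ht0
      simp only [slope_def_field, sub_zero, hr0] at ht
      have := (div_pos_iff_of_pos_right ht0').mp ht
      linarith
    obtain ⟨t₁, h4, h5⟩ := mem_nhdsGT_iff_exists_Ioo_subset.mp h3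
    exact ⟨t₁, h4, fun t ht => h5 ht⟩
  -- The times are kept away from `0`, where `r = R` as well, so that the infimum of `A` is the
  -- first return.
  set A : Set ℝ := Icc (min (t₁ / 2) B') B' ∩ r ⁻¹' Iic R with hA
  have hmin : 0 < min (t₁ / 2) B' := lt_min (by linarith) hB'pos
  have hout : ∀ t, 0 < t → t ≤ B' → t ∉ A → R < r t := by
    intro t ht htB htA
    by_contra hcon
    refine htA ⟨⟨?_, htB⟩, not_lt.mp hcon⟩
    by_contra hlt
    exact hcon (ht₁ t ⟨ht, by have := (not_le.mp hlt).trans_le (min_le_left _ _); linarith⟩)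
  have hAne : A.Nonempty := by
    by_contra hemp
    rw [not_nonempty_iff_eq_empty] at hemp
    have hge : ∀ t ∈ Icc 0 B', R ≤ r t := by
      intro t ht
      rcases ht.1.eq_or_lt with h | h
      · rw [← h, hr0]
      · exact (hout t h ht.2 (by simp [hemp])).le
    have h1 := le_sub_mul_sq_of_accel_le (κ := κ)
      (g := fun t => M * powCutoff (-(α + 1)) (R / 2) (r t)) (L := B')
      (fun t ht => ⟨(hrw t (hI (by linarith) ht)).1.mono (hI (by linarith)),
        (hrw t (hI (by linarith) ht)).2.mono (hI (by linarith))⟩)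
      (fun t ht => by
        have hRr := hge t ht
        rw [powCutoff_of_le _ (half_pos hR) (by linarith)]
        exact mul_le_mul_of_nonneg_left (Real.rpow_le_rpow_of_nonpos (by linarith)
          (hrle B' (by linarith) hge t ht) hp) hM.le)
      (t := B') ⟨hB'pos.le, le_rfl⟩
    have h2 := hge B' ⟨hB'pos.le, le_rfl⟩
    rw [hr0, hw0] at h1
    have h3 : κ * B' = 2 * w₀ + κ := by rw [hB']; field_simp
    nlinarith
  have hAcl : IsClosed A := by
    refine (hrc.mono ?_).preimage_isClosed_of_isClosed isClosed_Icc isClosed_Iic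
    exact Icc_subset_Icc (by linarith) (by linarith)
  have hAbdd : BddBelow A := ⟨_, fun t ht => ht.1.1⟩
  set T₀ := sInf A with hT₀
  have hT₀A : T₀ ∈ A := hAcl.csInf_mem hAne hAbdd
  have hT₀pos : 0 < T₀ := hmin.trans_le hT₀A.1.1
  have hT₀B : T₀ ≤ B' := hT₀A.1.2
  have hlt : ∀ t ∈ Ioo 0 T₀, R < r t := fun t ht =>
    hout t ht.1 (ht.2.le.trans hT₀B) fun h => (csInf_le hAbdd h).not_gt ht.2
  have hderT : HasDerivAt r (w T₀) T₀ := hderat T₀ ⟨by linarith, by linarith⟩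
  have hfin : r T₀ = R := by
    refine le_antisymm hT₀A.2 ?_
    refine ge_of_tendsto (hderT.continuousAt.tendsto.mono_left (nhdsWithin_le_nhds (s := Iio T₀))) ?_
    filter_upwards [Ioo_mem_nhdsLT hT₀pos] with t ht using (hlt t ht).le
  have hge : ∀ t ∈ Icc 0 T₀, R ≤ r t := by
    intro t ht
    rcases ht.1.eq_or_lt with h | h
    · rw [← h, hr0]
    · rcases ht.2.eq_or_lt with h' | h'
      · rw [h', hfin]
      · exact (hlt t ⟨h, h'⟩).le
  have hwsq : ∀ t ∈ Icc 0 T₀, w t ^ 2 ≤ w₀ ^ 2 := by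
    intro t ht
    have h1 := henergy T₀ (by linarith) hge t ht
    have h2 : M / (α * r t ^ α) ≤ M / (α * R ^ α) := by
      have := hge t ht
      gcongr
    nlinarith
  -- The velocity is at most `0` because `r > R` just before `T₀`; it is nonzero because the energy
  -- gives it the speed `w₀ > 0` at radius `R`.
  have hfin' : w T₀ < 0 := by
    have h1 := henergy T₀ (by linarith) hge T₀ ⟨hT₀pos.le, le_rfl⟩
    have h2 : w T₀ ≤ 0 := by
      by_contra hcon
      have h3 := (hasDerivAt_iff_tendsto_slope.mp hderT).eventually
        (lt_mem_nhds (not_le.mp hcon))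
      have h4 := nhdsWithin_mono T₀ (fun x (hx : x ∈ Iio T₀) => ne_of_lt hx) h3
      have h4' : ∀ᶠ t in 𝓝[<] T₀, 0 < slope r T₀ t := h4
      obtain ⟨t, ht, ht'⟩ := (h4'.and (Ioo_mem_nhdsLT hT₀pos)).exists
      simp only [slope_def_field, hfin] at ht
      exact lt_asymm ht (div_neg_of_pos_of_neg (sub_pos.mpr (hlt t ht')) (sub_neg.mpr ht'.2))
    rcases h2.lt_or_eq with h | h
    · exact h
    · exfalso
      rw [hfin, h] at h1
      nlinarith
  obtain ⟨β, hβ, hβ1, hβ'⟩ : ∃ β > 0, β ≤ 1 ∧ ∀ t ∈ Icc (-β) (T₀ + β), R / 2 < r t := by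
    have hnear : ∀ t ∈ Ioo (-B) B, r t = R → ∃ δ > 0, ∀ s, |s - t| < δ → R / 2 < r s := by
      intro t ht hrt
      have := (hderat t ht).continuousAt.eventually (lt_mem_nhds (show R / 2 < r t by linarith))
      obtain ⟨δ, hδ, h⟩ := Metric.eventually_nhds_iff.mp this
      exact ⟨δ, hδ, fun s hs => h hs⟩
    obtain ⟨δ₀, hδ₀, h₀⟩ := hnear 0 ⟨by linarith, by linarith⟩ hr0
    obtain ⟨δ₁, hδ₁, h₁⟩ := hnear T₀ ⟨by linarith, by linarith⟩ hfin
    refine ⟨min 1 (min (δ₀ / 2) (δ₁ / 2)), by positivity, min_le_left _ _, fun t ht => ?_⟩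
    have hm0 : min 1 (min (δ₀ / 2) (δ₁ / 2)) ≤ δ₀ / 2 := (min_le_right _ _).trans (min_le_left _ _)
    have hm1 : min 1 (min (δ₀ / 2) (δ₁ / 2)) ≤ δ₁ / 2 := (min_le_right _ _).trans (min_le_right _ _)
    rcases lt_or_ge t 0 with h | h
    · exact h₀ t (by rw [abs_lt]; constructor <;> linarith [ht.1])
    · rcases le_or_gt t T₀ with h' | h'
      · linarith [hge t ⟨h, h'⟩]
      · exact h₁ t (by rw [abs_lt]; constructor <;> linarith [ht.2])
  have hsub : Icc (-β) (T₀ + β) ⊆ Icc (-B) B := Icc_subset_Icc (by linarith) (by linarith)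
  exact ⟨β, T₀, r, w,
    { margin_pos := hβ
      time_pos := hT₀pos
      hasDeriv := fun t ht => (hrw t (hsub ht)).1.mono hsub
      hasDeriv' := fun t ht => by
        rw [← hforce t (hβ' t ht).le]
        exact (hrw t (hsub ht)).2.mono hsub
      start := hr0
      start' := hw0
      half_lt := hβ'
      lt := hlt
      finish := hfin
      finish' := hfin'
      le := hrle T₀ (by linarith) hge
      abs_le := fun t ht => abs_le_of_sq_le_sq (hwsq t ht) hw₀pos.le }⟩

end RotatingCentres

end

/-! ### The family of orbits leaving the point `R` -/

open Set

noncomputable section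

namespace RotatingCentres

open Filter Topology

variable {N : ℕ}

theorem IsRadialOrbit.shrink {α M R β β' T₀ : ℝ} {r w : ℝ → ℝ} (h : IsRadialOrbit α M R β T₀ r w)
    (h0 : 0 < β') (hβ : β' ≤ β) : IsRadialOrbit α M R β' T₀ r w := by
  have hsub : Icc (-β') (T₀ + β') ⊆ Icc (-β) (T₀ + β) :=
    Icc_subset_Icc (by linarith) (by linarith)
  exact
    { margin_pos := h0
      time_pos := h.time_pos
      hasDeriv := fun t ht => (h.hasDeriv t (hsub ht)).mono hsub
      hasDeriv' := fun t ht => (h.hasDeriv' t (hsub ht)).mono hsub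
      start := h.start
      start' := h.start'
      half_lt := fun t ht => h.half_lt t (hsub ht)
      lt := h.lt
      finish := h.finish
      finish' := h.finish'
      le := h.le
      abs_le := h.abs_le }

/-- The tube lemma: a strict property of the reference orbit on a compact time interval passes to
all nearby parameters. -/
theorem eventually_forall_mem_of_continuousOn {X Q Y : Type*} [TopologicalSpace X]
    [TopologicalSpace Q] [TopologicalSpace Y] {f : X × Q → Y} {S : Set (X × Q)} (hS : IsOpen S)
    (hf : ContinuousOn f S) {K : Set X} (hK : IsCompact K) {q₀ : Q} (hKS : ∀ t ∈ K, (t, q₀) ∈ S)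
    {U : Set Y} (hU : IsOpen U) (h : ∀ t ∈ K, f (t, q₀) ∈ U) :
    ∀ᶠ q in 𝓝 q₀, ∀ t ∈ K, (t, q) ∈ S ∧ f (t, q) ∈ U := by
  refine hK.eventually_forall_of_forall_eventually fun t ht => ?_
  have h1 : ∀ᶠ p in 𝓝 (t, q₀), p ∈ S ∧ f p ∈ U :=
    Eventually.and (hS.mem_nhds (hKS t ht)) ((hf.continuousAt (hS.mem_nhds (hKS t ht))).eventually
      (hU.mem_nhds (h t ht)))
  exact (continuous_swap.tendsto (q₀, t)).eventually h1

theorem centredForce_zero (α : ℝ) (m : Fin N → ℝ) (z : ℂ) :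
    centredForce α m 0 0 z = -(totalMass m * (‖z‖ ^ 2) ^ (-(α + 2) / 2)) • z := by
  simp [centredForce, totalMass, Finset.sum_mul]

theorem centredForce_zero_ofReal (α : ℝ) (m : Fin N → ℝ) {x : ℝ} (hx : 0 < x) :
    centredForce α m 0 0 x = ((-(totalMass m * x ^ (-(α + 1))) : ℝ) : ℂ) := by
  have h : (x ^ 2) ^ (-(α + 2) / 2) * x = x ^ (-(α + 1)) := by
    rw [← Real.rpow_natCast_mul hx.le]
    nth_rw 2 [← Real.rpow_one x]
    rw [← Real.rpow_add hx]
    congr 1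
    push_cast; ring
  rw [centredForce_zero, Complex.norm_real, Real.norm_eq_abs, sq_abs, ← h, Complex.real_smul]
  push_cast; ring

/-- The square of the radial velocity of an orbit of energy `-1` which starts at the point `R` with
angular velocity `ω`. -/
def radialSpeedSq (α : ℝ) (m : Fin N → ℝ) (R : ℝ) (q : (Fin N → ℂ) × ℝ × ℝ) : ℝ :=
  2 * (centredPotential α m q.1 q.2.1 R - 1) - R ^ 2 * q.2.2 ^ 2

/-- The velocity of an orbit of energy `-1` which leaves the disc of radius `R` at the point `R`
with angular velocity `ω`. -/
def initialVelocity (α : ℝ) (m : Fin N → ℝ) (R : ℝ) (q : (Fin N → ℂ) × ℝ × ℝ) : ℂ :=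
  (√(radialSpeedSq α m R q) : ℝ) + ((R * q.2.2 : ℝ) : ℂ) * Complex.I

theorem radialSpeedSq_zero (α : ℝ) (m : Fin N → ℝ) {R : ℝ} (hR : 0 < R) :
    radialSpeedSq α m R 0 = 2 * (-1 + totalMass m / (α * R ^ α)) := by
  simp [radialSpeedSq, centredPotential, totalMass, Finset.sum_div, abs_of_pos hR]
  ring

theorem contDiffAt_radialSpeedSq {α : ℝ} (hα : 0 < α) (m : Fin N → ℝ) {R : ℝ} (hR : 0 < R) :
    ContDiffAt ℝ 1 (radialSpeedSq α m R) 0 := by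
  have h1 : ∀ k ∈ (Finset.univ : Finset (Fin N)), ContDiffAt ℝ 1
      (fun q : (Fin N → ℂ) × ℝ × ℝ => m k / (α * ‖(R : ℂ) - q.1 k‖ ^ α)) 0 := by
    intro k _
    have hne : (R : ℂ) - (0 : (Fin N → ℂ) × ℝ × ℝ).1 k ≠ 0 := by simp [hR.ne']
    have h2 : ContDiffAt ℝ 1 (fun q : (Fin N → ℂ) × ℝ × ℝ => (R : ℂ) - q.1 k) 0 := by fun_prop
    have h3 := h2.norm ℝ hne
    have h4 := h3.rpow_const_of_ne (p := α) (norm_ne_zero_iff.mpr hne)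
    exact contDiffAt_const.div (contDiffAt_const.mul h4)
      (mul_ne_zero hα.ne' (Real.rpow_pos_of_pos (norm_pos_iff.mpr hne) α).ne')
  have h2 := ContDiffAt.sum h1
  have h3 : ContDiffAt ℝ 1 (fun q : (Fin N → ℂ) × ℝ × ℝ => q.2.1 ^ 2 / 2 * ‖(R : ℂ)‖ ^ 2) 0 := by
    fun_prop
  have h4 : ContDiffAt ℝ 1 (fun q : (Fin N → ℂ) × ℝ × ℝ => R ^ 2 * q.2.2 ^ 2) 0 := by
    fun_prop
  exact (contDiffAt_const.mul ((h3.add h2).sub contDiffAt_const)).sub h4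

theorem contDiffAt_initialVelocity {α : ℝ} (hα : 0 < α) (m : Fin N → ℝ) {R : ℝ} (hR : 0 < R)
    (h : 0 < radialSpeedSq α m R 0) : ContDiffAt ℝ 1 (initialVelocity α m R) 0 := by
  have h1 := (contDiffAt_radialSpeedSq hα m hR).sqrt h.ne'
  have h2 : ContDiffAt ℝ 1 (fun q : (Fin N → ℂ) × ℝ × ℝ => R * q.2.2) 0 := by fun_prop
  exact (Complex.ofRealCLM.contDiff.contDiffAt.comp _ h1).add
    ((Complex.ofRealCLM.contDiff.contDiffAt.comp _ h2).mul contDiffAt_const)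

/-- The family of the orbits of energy `-1` which leave the disc of radius `R` at the point `R`, for
the centres `a`, the angular velocity `ν` of the frame and the initial angular velocity `ω`, where
`q = (a, ν, ω)` is in the neighbourhood `U` of `0`. -/
structure IsOrbitFamily (α : ℝ) (m : Fin N → ℝ) (R β T₀ : ℝ) (r w : ℝ → ℝ)
    (U : Set ((Fin N → ℂ) × ℝ × ℝ)) (Z V : ℝ → (Fin N → ℂ) × ℝ × ℝ → ℂ) : Prop where
  isOpen : IsOpen U
  zero_mem : 0 ∈ U
  contDiffOn : ContDiffOn ℝ 1 (fun p : ℝ × (Fin N → ℂ) × ℝ × ℝ => Z p.1 p.2)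
    (Ioo (-β) (T₀ + β) ×ˢ U)
  contDiffOn' : ContDiffOn ℝ 1 (fun p : ℝ × (Fin N → ℂ) × ℝ × ℝ => V p.1 p.2)
    (Ioo (-β) (T₀ + β) ×ˢ U)
  hasDerivAt : ∀ q ∈ U, ∀ t ∈ Ioo (-β) (T₀ + β), HasDerivAt (fun s => Z s q) (V t q) t
  hasDerivAt' : ∀ q ∈ U, ∀ t ∈ Ioo (-β) (T₀ + β), HasDerivAt (fun s => V s q)
    (centredForce α m q.1 q.2.1 (Z t q) - 2 * (q.2.1 : ℂ) * Complex.I * V t q) t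
  start : ∀ q ∈ U, Z 0 q = R
  start' : ∀ q ∈ U, V 0 q = initialVelocity α m R q
  radial : ∀ t ∈ Ioo (-β) (T₀ + β), Z t 0 = r t
  radial' : ∀ t ∈ Ioo (-β) (T₀ + β), V t 0 = w t
  half_lt : ∀ q ∈ U, ∀ t ∈ Ioo (-β) (T₀ + β), R / 2 < ‖Z t q‖
  centres_le : ∀ q ∈ U, ‖q.1‖ ≤ R / 4
  radialSpeedSq_pos : ∀ q ∈ U, 0 < radialSpeedSq α m R q

/-- The centres and `ν` are carried as constant components of the state, so that dependence on
parameters becomes dependence on initial data. The cutoff at distance `R / 4` is inactive, since the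
orbits stay beyond `R / 2` and the centres within `R / 4`. Halving the margin leaves a compact time
interval for the tube lemma. -/
theorem exists_isOrbitFamily {α : ℝ} (hα : 0 < α) {m : Fin N → ℝ} {R β T₀ : ℝ} (hR : 0 < R)
    (hE : 1 < totalMass m / (α * R ^ α)) {r w : ℝ → ℝ}
    (h : IsRadialOrbit α (totalMass m) R β T₀ r w) :
    ∃ (U : Set ((Fin N → ℂ) × ℝ × ℝ)) (Z V : ℝ → (Fin N → ℂ) × ℝ × ℝ → ℂ),
      IsOrbitFamily α m R (β / 2) T₀ r w U Z V := by
  have hβ := h.margin_pos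
  have hT := h.time_pos
  have hs₀ : 0 < (R / 4) ^ 2 := by positivity
  set γ : ℝ → ℂ × ℂ × (Fin N → ℂ) × ℝ := fun t => (r t, w t, 0, 0) with hγdef
  have hγ : ∀ t ∈ Icc (-β) (T₀ + β), HasDerivWithinAt γ (cutoffField α m ((R / 4) ^ 2) (γ t))
      (Icc (-β) (T₀ + β)) t := by
    intro t ht
    have hr := h.half_lt t ht
    have hr0 : 0 < r t := by linarith
    rw [cutoffField_eq hs₀, centredForce_zero_ofReal α m hr0]
    · refine ((h.hasDeriv t ht).ofReal_comp).prodMk (HasDerivWithinAt.prodMk ?_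
        ((hasDerivWithinAt_const t _ 0).prodMk (hasDerivWithinAt_const t _ 0)))
      simpa using (h.hasDeriv' t ht).ofReal_comp
    · intro k
      refine sq_le_norm_sub_sq (by positivity) (by simp; positivity) ?_ k
      rw [Complex.norm_real, Real.norm_of_nonneg hr0.le]; linarith
  obtain ⟨W, hWo, hW0, φ, hφγ, hφ0, hφd, hφC⟩ := exists_contDiffOn_flow
    (contDiff_cutoffField α m hs₀) (by linarith : -β < 0) (by linarith : 0 < T₀ + β) hγ
  have hconst : ∀ x ∈ W, ∀ t ∈ Ioo (-β) (T₀ + β), (φ t x).2.2 = x.2.2 := by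
    intro x hx t ht
    have h0 : (0 : ℝ) ∈ Ioo (-β) (T₀ + β) := ⟨by linarith, by linarith⟩
    have hd : ∀ s ∈ Ioo (-β) (T₀ + β), HasDerivAt (fun s => (φ s x).2.2) 0 s := fun s hs =>
      (hφd x hx s hs).snd.snd
    rw [isOpen_Ioo.is_const_of_deriv_eq_zero isPreconnected_Ioo
      (fun s hs => (hd s hs).differentiableAt.differentiableWithinAt)
      (fun s hs => (hd s hs).deriv) ht h0, hφ0 x hx]
  let init : (Fin N → ℂ) × ℝ × ℝ → ℂ × ℂ × (Fin N → ℂ) × ℝ := fun q =>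
    ((R : ℂ), initialVelocity α m R q, q.1, q.2.1)
  have hsp : 0 < radialSpeedSq α m R 0 := by
    rw [radialSpeedSq_zero α m hR]; linarith
  have hinitC : ContDiffAt ℝ 1 init 0 :=
    contDiffAt_const.prodMk ((contDiffAt_initialVelocity hα m hR hsp).prodMk (by fun_prop))
  have hγ0 : init 0 = γ 0 := by
    simp only [init, hγdef, h.start, h.start', initialVelocity, radialSpeedSq_zero α m hR]
    simp
  have hev : ∀ᶠ q in 𝓝 (0 : (Fin N → ℂ) × ℝ × ℝ),
      ContDiffAt ℝ 1 init q ∧ init q ∈ W ∧ ‖q.1‖ < R / 4 ∧ 0 < radialSpeedSq α m R q := by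
    refine (hinitC.eventually (by simp)).and ((hinitC.continuousAt.eventually
      (hWo.mem_nhds (hγ0 ▸ hW0))).and (Eventually.and ?_ ?_))
    · exact (continuous_fst.norm.continuousAt).eventually (gt_mem_nhds (by simp; positivity))
    · exact (contDiffAt_radialSpeedSq hα m hR).continuousAt.eventually (lt_mem_nhds hsp)
  obtain ⟨U₁, hU₁, hU₁o, hU₁0⟩ := eventually_nhds_iff.mp hev
  set S := Ioo (-β) (T₀ + β) ×ˢ U₁ with hS
  have hSo : IsOpen S := isOpen_Ioo.prod hU₁o
  have hflow : ContDiffOn ℝ 1 (fun p : ℝ × (Fin N → ℂ) × ℝ × ℝ => φ p.1 (init p.2)) S := by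
    have h1 : ContDiffOn ℝ 1 (fun p : ℝ × (Fin N → ℂ) × ℝ × ℝ => (p.1, init p.2)) S := by
      refine contDiffOn_fst.prodMk ?_
      have : ContDiffOn ℝ 1 init U₁ := fun q hq => (hU₁ q hq).1.contDiffWithinAt
      exact this.comp contDiffOn_snd fun p hp => hp.2
    exact hφC.comp h1 fun p hp => ⟨hp.1, (hU₁ _ hp.2).2.1⟩
  have hsub : Icc (-(β / 2)) (T₀ + β / 2) ⊆ Ioo (-β) (T₀ + β) :=
    Icc_subset_Ioo (by linarith) (by linarith)
  have htube := eventually_forall_mem_of_continuousOn hSo (hflow.continuousOn.fst.norm)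
    (isCompact_Icc (a := -(β / 2)) (b := T₀ + β / 2)) (q₀ := 0)
    (fun t ht => ⟨hsub ht, hU₁0⟩) (isOpen_Ioi (a := R / 2)) (fun t ht => by
      have ht' := Ioo_subset_Icc_self (hsub ht)
      have hr := h.half_lt t ht'
      change R / 2 < ‖(φ t (init 0)).1‖
      rw [hγ0, hφγ t ht', hγdef, Complex.norm_real, Real.norm_of_nonneg (by linarith)]
      exact hr)
  obtain ⟨U₂, hU₂, hU₂o, hU₂0⟩ := eventually_nhds_iff.mp htube
  have hsub' : Ioo (-(β / 2)) (T₀ + β / 2) ⊆ Ioo (-β) (T₀ + β) := Ioo_subset_Icc_self.trans hsub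
  have hsubS : Ioo (-(β / 2)) (T₀ + β / 2) ×ˢ (U₁ ∩ U₂) ⊆ S :=
    prod_mono hsub' inter_subset_left
  have hder : ∀ q ∈ U₁ ∩ U₂, ∀ t ∈ Ioo (-(β / 2)) (T₀ + β / 2),
      HasDerivAt (fun s => φ s (init q)) ((φ t (init q)).2.1, centredForce α m q.1 q.2.1
        (φ t (init q)).1 - 2 * (q.2.1 : ℂ) * Complex.I * (φ t (init q)).2.1, 0, 0) t := by
    intro q hq t ht
    have h1 := hφd (init q) (hU₁ q hq.1).2.1 t (hsub' ht)
    have h2 := hconst (init q) (hU₁ q hq.1).2.1 t (hsub' ht)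
    have h3 : φ t (init q) = ((φ t (init q)).1, (φ t (init q)).2.1, q.1, q.2.1) := by
      conv_lhs => rw [← Prod.mk.eta (p := φ t (init q)), ← Prod.mk.eta (p := (φ t (init q)).2), h2]
    rw [h3, cutoffField_eq hs₀] at h1
    · exact h1
    · intro k
      refine sq_le_norm_sub_sq (by positivity) (hU₁ q hq.1).2.2.1.le ?_ k
      have : R / 2 < ‖(φ t (init q)).1‖ := (hU₂ q hq.2 t (Ioo_subset_Icc_self ht)).2
      linarith
  refine ⟨U₁ ∩ U₂, fun t q => (φ t (init q)).1, fun t q => (φ t (init q)).2.1,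
    { isOpen := hU₁o.inter hU₂o
      zero_mem := ⟨hU₁0, hU₂0⟩
      contDiffOn := (contDiff_fst.comp_contDiffOn hflow).mono hsubS
      contDiffOn' := (contDiff_fst.comp_contDiffOn (contDiff_snd.comp_contDiffOn hflow)).mono hsubS
      hasDerivAt := fun q hq t ht => (hder q hq t ht).fst
      hasDerivAt' := fun q hq t ht => (hder q hq t ht).snd.fst
      start := fun q hq => by rw [hφ0 _ (hU₁ q hq.1).2.1]
      start' := fun q hq => by rw [hφ0 _ (hU₁ q hq.1).2.1]
      radial := fun t ht => by rw [hγ0, hφγ t (Ioo_subset_Icc_self (hsub' ht))]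
      radial' := fun t ht => by rw [hγ0, hφγ t (Ioo_subset_Icc_self (hsub' ht))]
      half_lt := fun q hq t ht => (hU₂ q hq.2 t (Ioo_subset_Icc_self ht)).2
      centres_le := fun q hq => (hU₁ q hq.1).2.2.1.le
      radialSpeedSq_pos := fun q hq => (hU₁ q hq.1).2.2.2 }⟩

end RotatingCentres

end

/-! ### Nondegeneracy of the shooting problem -/

open Set

noncomputable section

namespace RotatingCentres

open Filter Topology

variable {N : ℕ} {α : ℝ} {m : Fin N → ℝ} {R β T₀ : ℝ} {r w : ℝ → ℝ}
  {U : Set ((Fin N → ℂ) × ℝ × ℝ)} {Z V : ℝ → (Fin N → ℂ) × ℝ × ℝ → ℂ}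

theorem IsRadialOrbit.Icc_subset {M β T₀ : ℝ} (hr : IsRadialOrbit α M R β T₀ r w) :
    Icc 0 T₀ ⊆ Ioo (-β) (T₀ + β) :=
  Icc_subset_Ioo (by linarith [hr.margin_pos]) (by linarith [hr.margin_pos])

theorem IsRadialOrbit.le_radius {M : ℝ} (hr : IsRadialOrbit α M R β T₀ r w) {t : ℝ}
    (ht : t ∈ Icc 0 T₀) : R ≤ r t := by
  rcases ht.1.eq_or_lt with h | h
  · rw [← h, hr.start]
  · rcases ht.2.eq_or_lt with h' | h'
    · rw [h', hr.finish]
    · exact (hr.lt t ⟨h, h'⟩).le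

theorem IsOrbitFamily.isOpen_prod (h : IsOrbitFamily α m R β T₀ r w U Z V) :
    IsOpen (Ioo (-β) (T₀ + β) ×ˢ U) := isOpen_Ioo.prod h.isOpen

/-- For the unperturbed problem (`a = 0`, `ν = 0`) the angular momentum is conserved. -/
theorem IsOrbitFamily.angularMomentum (h : IsOrbitFamily α m R β T₀ r w U Z V)
    {M : ℝ} (hr : IsRadialOrbit α M R β T₀ r w) {ω : ℝ} (hω : ((0, 0, ω) : (Fin N → ℂ) × ℝ × ℝ) ∈ U)
    {t : ℝ} (ht : t ∈ Ioo (-β) (T₀ + β)) :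
    (Z t (0, 0, ω)).re * (V t (0, 0, ω)).im - (Z t (0, 0, ω)).im * (V t (0, 0, ω)).re
      = R ^ 2 * ω := by
  set q : (Fin N → ℂ) × ℝ × ℝ := (0, 0, ω) with hq
  have h0 : (0 : ℝ) ∈ Ioo (-β) (T₀ + β) :=
    ⟨by linarith [hr.margin_pos], by linarith [hr.margin_pos, hr.time_pos]⟩
  have hd : ∀ s ∈ Ioo (-β) (T₀ + β), HasDerivAt
      (fun s => (Z s q).re * (V s q).im - (Z s q).im * (V s q).re) 0 s := by
    intro s hs
    have h1 := h.hasDerivAt q hω s hs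
    have h2 := h.hasDerivAt' q hω s hs
    have h1r : HasDerivAt (fun s => (Z s q).re) (V s q).re s :=
      Complex.reCLM.hasFDerivAt.comp_hasDerivAt s h1
    have h1i : HasDerivAt (fun s => (Z s q).im) (V s q).im s :=
      Complex.imCLM.hasFDerivAt.comp_hasDerivAt s h1
    have h2r := Complex.reCLM.hasFDerivAt.comp_hasDerivAt s h2
    have h2i := Complex.imCLM.hasFDerivAt.comp_hasDerivAt s h2
    refine ((h1r.mul h2i).sub (h1i.mul h2r)).congr_deriv ?_
    simp only [hq, centredForce_zero]
    simp
    ring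
  have := isOpen_Ioo.is_const_of_deriv_eq_zero isPreconnected_Ioo
    (fun s hs => (hd s hs).differentiableAt.differentiableWithinAt)
    (fun s hs => (hd s hs).deriv) ht h0
  rw [this, h.start q hω, h.start' q hω]
  simp [initialVelocity, hq]
  ring

/-- Orbits of the unperturbed problem which leave the disc at slightly different angles come back at
different points: the return point has non-zero derivative with respect to the initial angular
velocity, in the direction of the circle. -/
theorem IsOrbitFamily.exists_hasDerivAt_im_pos (hR : 0 < R)
    (h : IsOrbitFamily α m R β T₀ r w U Z V) {M : ℝ} (hr : IsRadialOrbit α M R β T₀ r w) :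
    ∃ d : ℂ, HasDerivAt (fun ω : ℝ => Z T₀ (0, 0, ω)) d 0 ∧ 0 < d.im := by
  have hT := hr.time_pos
  have hβ := hr.margin_pos
  have hTI : T₀ ∈ Ioo (-β) (T₀ + β) := ⟨by linarith, by linarith⟩
  have hdiff : DifferentiableAt ℝ (fun ω : ℝ => Z T₀ (0, 0, ω)) 0 := by
    have h1 := (h.contDiffOn.contDiffAt (h.isOpen_prod.mem_nhds
      (x := (T₀, ((0, 0, 0) : (Fin N → ℂ) × ℝ × ℝ))) ⟨hTI, h.zero_mem⟩)).differentiableAt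
        one_ne_zero
    have h2 : DifferentiableAt ℝ (fun ω : ℝ => (T₀, ((0, 0, ω) : (Fin N → ℂ) × ℝ × ℝ))) 0 := by
      fun_prop
    exact DifferentiableAt.comp (g := fun p : ℝ × (Fin N → ℂ) × ℝ × ℝ => Z p.1 p.2)
      (f := fun ω : ℝ => (T₀, ((0, 0, ω) : (Fin N → ℂ) × ℝ × ℝ))) 0 h1 h2
  refine ⟨_, hdiff.hasDerivAt, ?_⟩
  set d := deriv (fun ω : ℝ => Z T₀ (0, 0, ω)) 0
  have him : HasDerivAt (fun ω : ℝ => (Z T₀ (0, 0, ω)).im) d.im 0 :=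
    Complex.imCLM.hasFDerivAt.comp_hasDerivAt 0 hdiff.hasDerivAt
  -- The bound is strict, hence stable under perturbation of the radial orbit.
  obtain ⟨C, hC0, hC⟩ : ∃ C > 0, ∀ t ∈ Icc 0 T₀, r t < C := by
    refine ⟨max R ((M / α) ^ (1 / α)) + 1, by positivity, fun t ht => ?_⟩
    have := hr.le t ht
    have := le_max_right R ((M / α) ^ (1 / α))
    linarith
  have htube := eventually_forall_mem_of_continuousOn h.isOpen_prod h.contDiffOn.continuousOn
    (isCompact_Icc (a := 0) (b := T₀)) (q₀ := 0) (fun t ht => ⟨hr.Icc_subset ht, h.zero_mem⟩)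
    (U := {z : ℂ | R / 2 < z.re ∧ z.re < C})
    ((isOpen_lt continuous_const Complex.continuous_re).inter
      (isOpen_lt Complex.continuous_re continuous_const))
    (fun t ht => by
      simp only [h.radial t (hr.Icc_subset ht)]
      exact ⟨by rw [Complex.ofReal_re]; linarith [hr.le_radius ht], by simpa using hC t ht⟩)
  have hline : Tendsto (fun ω : ℝ => ((0, 0, ω) : (Fin N → ℂ) × ℝ × ℝ)) (𝓝 0) (𝓝 0) :=
    (by fun_prop : Continuous fun ω : ℝ => ((0, 0, ω) : (Fin N → ℂ) × ℝ × ℝ)).tendsto 0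
  have hlow : ∀ᶠ ω : ℝ in 𝓝[>] 0, R / 2 * (R ^ 2 / C ^ 2 * T₀)
      ≤ slope (fun ω : ℝ => (Z T₀ (0, 0, ω)).im) 0 ω := by
    filter_upwards [nhdsWithin_le_nhds (hline.eventually htube), self_mem_nhdsWithin] with ω hω hpos
    have hpos' : (0 : ℝ) < ω := hpos
    set q : (Fin N → ℂ) × ℝ × ℝ := (0, 0, ω) with hq
    have hqU : q ∈ U := (hω 0 ⟨le_rfl, hT.le⟩).1.2
    -- The tangent of the polar angle has derivative angular momentum over `Re²`, which is at least
    -- `R² ω / C²`. Integrating over `[0, T₀]` bounds `Im Z` below by a fixed multiple of `ω`, and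
    -- the right-hand slopes pass to the limit.
    have hd : ∀ s ∈ Icc 0 T₀, HasDerivAt (fun s => (Z s q).im / (Z s q).re)
        (R ^ 2 * ω / (Z s q).re ^ 2) s := by
      intro s hs
      have h1 := h.hasDerivAt q hqU s (hr.Icc_subset hs)
      have hne : (Z s q).re ≠ 0 := by
        have : R / 2 < (Z s q).re := (hω s hs).2.1
        linarith
      have h1r : HasDerivAt (fun s => (Z s q).re) (V s q).re s :=
        Complex.reCLM.hasFDerivAt.comp_hasDerivAt s h1
      have h1i : HasDerivAt (fun s => (Z s q).im) (V s q).im s :=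
        Complex.imCLM.hasFDerivAt.comp_hasDerivAt s h1
      refine (h1i.div h1r hne).congr_deriv ?_
      rw [← h.angularMomentum hr hqU (hr.Icc_subset hs)]
      ring
    have hmv := (convex_Icc 0 T₀).mul_sub_le_image_sub_of_le_deriv
      (f := fun s => (Z s q).im / (Z s q).re) (C := R ^ 2 * ω / C ^ 2)
      (fun s hs => (hd s hs).continuousAt.continuousWithinAt)
      (fun s hs => (hd s (interior_subset hs)).differentiableAt.differentiableWithinAt)
      (fun s hs => by
        have hs' := interior_subset hs
        rw [(hd s hs').deriv]
        have h1 : R / 2 < (Z s q).re := (hω s hs').2.1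
        have h2 : (Z s q).re < C := (hω s hs').2.2
        have h3 : 0 < (Z s q).re := by linarith
        gcongr)
      0 ⟨le_rfl, hT.le⟩ T₀ ⟨hT.le, le_rfl⟩ hT.le
    rw [h.start q hqU, Complex.ofReal_im, zero_div, sub_zero, sub_zero] at hmv
    have hre : R / 2 < (Z T₀ q).re := (hω T₀ ⟨hT.le, le_rfl⟩).2.1
    have hre0 : 0 < (Z T₀ q).re := by linarith
    rw [le_div_iff₀ hre0] at hmv
    have h0 : (Z T₀ (0, 0, 0)).im = 0 := by
      have := h.radial T₀ hTI
      change Z T₀ (0, 0, 0) = r T₀ at this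
      rw [this, Complex.ofReal_im]
    rw [slope_def_field, h0, sub_zero, sub_zero, le_div_iff₀ hpos']
    refine le_trans ?_ hmv
    have : 0 ≤ R ^ 2 * ω / C ^ 2 * T₀ := by positivity
    calc R / 2 * (R ^ 2 / C ^ 2 * T₀) * ω = R ^ 2 * ω / C ^ 2 * T₀ * (R / 2) := by ring
      _ ≤ _ := by gcongr
  have hlim := (hasDerivAt_iff_tendsto_slope.mp him).mono_left
    (nhdsWithin_mono 0 fun x (hx : x ∈ Ioi (0 : ℝ)) => ne_of_gt hx)
  have := ge_of_tendsto hlim hlow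
  have hpos : 0 < R / 2 * (R ^ 2 / C ^ 2 * T₀) := by positivity
  linarith

/-- The map whose zeros `((a, ν, u), (t, ω))` are the orbits which are at the point `u` at the
time `t`. -/
def shootingMap (Z : ℝ → (Fin N → ℂ) × ℝ × ℝ → ℂ)
    (x : ((Fin N → ℂ) × ℝ × ℂ) × ℝ × ℝ) : ℂ :=
  Z x.2.1 (x.1.1, x.1.2.1, x.2.2) - x.1.2.2

theorem IsOrbitFamily.contDiffAt_shootingMap (h : IsOrbitFamily α m R β T₀ r w U Z V) {M : ℝ}
    (hr : IsRadialOrbit α M R β T₀ r w) :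
    ContDiffAt ℝ 1 (shootingMap Z) (((0, 0, (R : ℂ)) : (Fin N → ℂ) × ℝ × ℂ), T₀, 0) := by
  have hβ := hr.margin_pos
  have hT := hr.time_pos
  have h1 := h.contDiffOn.contDiffAt (h.isOpen_prod.mem_nhds
      (x := (T₀, ((0, 0, 0) : (Fin N → ℂ) × ℝ × ℝ))) ⟨⟨by linarith, by linarith⟩, h.zero_mem⟩)
  have h2 : ContDiffAt ℝ 1 (fun x : ((Fin N → ℂ) × ℝ × ℂ) × ℝ × ℝ =>
      ((x.2.1, x.1.1, x.1.2.1, x.2.2) : ℝ × (Fin N → ℂ) × ℝ × ℝ))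
      (((0, 0, (R : ℂ)) : (Fin N → ℂ) × ℝ × ℂ), T₀, 0) := by fun_prop
  have h3 : ContDiffAt ℝ 1 (fun x : ((Fin N → ℂ) × ℝ × ℂ) × ℝ × ℝ => x.1.2.2)
      (((0, 0, (R : ℂ)) : (Fin N → ℂ) × ℝ × ℂ), T₀, 0) := by fun_prop
  exact (ContDiffAt.comp (g := fun p : ℝ × (Fin N → ℂ) × ℝ × ℝ => Z p.1 p.2)
    (((0, 0, (R : ℂ)) : (Fin N → ℂ) × ℝ × ℂ), T₀, (0 : ℝ)) h1 h2).sub h3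

/-- The columns are `w T₀`, real and negative, and `d`, with positive imaginary part: a triangular
matrix with nonzero diagonal. Injectivity suffices, both spaces having real dimension 2. -/
theorem IsOrbitFamily.isInvertible_fderiv_shootingMap (hR : 0 < R)
    (h : IsOrbitFamily α m R β T₀ r w U Z V) {M : ℝ} (hr : IsRadialOrbit α M R β T₀ r w) :
    (fderiv ℝ (shootingMap Z) (((0, 0, (R : ℂ)) : (Fin N → ℂ) × ℝ × ℂ), T₀, 0)
      ∘L .inr ℝ ((Fin N → ℂ) × ℝ × ℂ) (ℝ × ℝ)).IsInvertible := by
  have hβ := hr.margin_pos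
  have hT := hr.time_pos
  have hTI : T₀ ∈ Ioo (-β) (T₀ + β) := ⟨by linarith, by linarith⟩
  set p : (Fin N → ℂ) × ℝ × ℂ := (0, 0, (R : ℂ)) with hp
  set L := fderiv ℝ (shootingMap Z) (p, T₀, 0) ∘L .inr ℝ ((Fin N → ℂ) × ℝ × ℂ) (ℝ × ℝ) with hL
  have hF : HasFDerivAt (fun y : ℝ × ℝ => shootingMap Z (p, y)) L (T₀, 0) :=
    (((h.contDiffAt_shootingMap hr).differentiableAt one_ne_zero).hasFDerivAt).comp (T₀, (0 : ℝ))
      (hasFDerivAt_prodMk_right p (T₀, (0 : ℝ)))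
  obtain ⟨d, hd, hdpos⟩ := h.exists_hasDerivAt_im_pos hR hr
  have hL1 : L (1, 0) = w T₀ := by
    have h1 : HasDerivAt (fun t : ℝ => shootingMap Z (p, t, 0)) (L (1, 0)) T₀ :=
      hF.comp_hasDerivAt (f := fun t : ℝ => (t, (0 : ℝ))) T₀ ((hasDerivAt_id T₀).prodMk (hasDerivAt_const T₀ (0 : ℝ)))
    have h2 : HasDerivAt (fun t : ℝ => shootingMap Z (p, t, 0)) (V T₀ 0) T₀ :=
      (h.hasDerivAt 0 h.zero_mem T₀ hTI).sub_const _
    rw [h1.unique h2, h.radial' T₀ hTI]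
  have hL2 : L (0, 1) = d := by
    have h1 : HasDerivAt (fun ω : ℝ => shootingMap Z (p, T₀, ω)) (L (0, 1)) 0 :=
      hF.comp_hasDerivAt (f := fun ω : ℝ => (T₀, ω)) 0 ((hasDerivAt_const (0 : ℝ) T₀).prodMk (hasDerivAt_id (0 : ℝ)))
    exact h1.unique (hd.sub_const _)
  have hLy : ∀ y : ℝ × ℝ, L y = y.1 • (w T₀ : ℂ) + y.2 • d := by
    intro y
    rw [← hL1, ← hL2, ← map_smul, ← map_smul, ← map_add]
    simp
  have hinj : Function.Injective L := by
    rw [injective_iff_map_eq_zero]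
    intro y hy
    rw [hLy] at hy
    have him := congrArg Complex.im hy
    have hre := congrArg Complex.re hy
    simp only [Complex.add_im, Complex.smul_im, Complex.ofReal_im, smul_eq_mul, mul_zero, zero_add,
      Complex.zero_im, Complex.add_re, Complex.smul_re, Complex.ofReal_re, Complex.zero_re]
      at him hre
    have h2 : y.2 = 0 := (mul_eq_zero.mp him).resolve_right hdpos.ne'
    rw [h2, zero_mul, add_zero] at hre
    have h1 : y.1 = 0 := (mul_eq_zero.mp hre).resolve_right hr.finish'.ne
    exact Prod.ext h1 h2
  let e := (L.toLinearMap.linearEquivOfInjective hinj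
    (by simp [Complex.finrank_real_complex])).toContinuousLinearEquiv
  exact ⟨e, by ext <;> simp [e]⟩

end RotatingCentres

end

/-! ### Confinement of the return time -/

open Set

noncomputable section

namespace RotatingCentres

open Filter Topology

variable {N : ℕ} {α : ℝ} {m : Fin N → ℝ} {R β T₀ : ℝ} {r w : ℝ → ℝ}
  {U : Set ((Fin N → ℂ) × ℝ × ℝ)} {Z V : ℝ → (Fin N → ℂ) × ℝ × ℝ → ℂ}

theorem IsOrbitFamily.hasDerivAt_norm_sq (h : IsOrbitFamily α m R β T₀ r w U Z V)
    {q : (Fin N → ℂ) × ℝ × ℝ} (hq : q ∈ U) {t : ℝ} (ht : t ∈ Ioo (-β) (T₀ + β)) :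
    HasDerivAt (fun t => ‖Z t q‖ ^ 2) (2 * inner ℝ (Z t q) (V t q)) t :=
  (h.hasDerivAt q hq t ht).norm_sq

theorem IsOrbitFamily.norm_lt_of_inner_pos (h : IsOrbitFamily α m R β T₀ r w U Z V)
    {q : (Fin N → ℂ) × ℝ × ℝ} (hq : q ∈ U) {s t : ℝ} (hst : s < t)
    (hI : Icc s t ⊆ Ioo (-β) (T₀ + β)) (hpos : ∀ x ∈ Icc s t, 0 < inner ℝ (Z x q) (V x q)) :
    ‖Z s q‖ < ‖Z t q‖ := by
  have hmono : StrictMonoOn (fun t => ‖Z t q‖ ^ 2) (Icc s t) :=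
    strictMonoOn_of_hasDerivWithinAt_pos (convex_Icc s t)
      (fun x hx => (h.hasDerivAt_norm_sq hq (hI hx)).continuousAt.continuousWithinAt)
      (fun x hx => (h.hasDerivAt_norm_sq hq (hI (interior_subset hx))).hasDerivWithinAt)
      (fun x hx => by linarith [hpos x (interior_subset hx)])
  exact lt_of_pow_lt_pow_left₀ 2 (norm_nonneg _)
    (hmono (left_mem_Icc.mpr hst.le) (right_mem_Icc.mpr hst.le) hst)

theorem IsOrbitFamily.norm_lt_of_inner_neg (h : IsOrbitFamily α m R β T₀ r w U Z V)
    {q : (Fin N → ℂ) × ℝ × ℝ} (hq : q ∈ U) {s t : ℝ} (hst : s < t)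
    (hI : Icc s t ⊆ Ioo (-β) (T₀ + β)) (hneg : ∀ x ∈ Icc s t, inner ℝ (Z x q) (V x q) < 0) :
    ‖Z t q‖ < ‖Z s q‖ := by
  have hanti : StrictAntiOn (fun t => ‖Z t q‖ ^ 2) (Icc s t) :=
    strictAntiOn_of_hasDerivWithinAt_neg (convex_Icc s t)
      (fun x hx => (h.hasDerivAt_norm_sq hq (hI hx)).continuousAt.continuousWithinAt)
      (fun x hx => (h.hasDerivAt_norm_sq hq (hI (interior_subset hx))).hasDerivWithinAt)
      (fun x hx => by linarith [hneg x (interior_subset hx)])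
  exact lt_of_pow_lt_pow_left₀ 2 (norm_nonneg _)
    (hanti (left_mem_Icc.mpr hst.le) (right_mem_Icc.mpr hst.le) hst)

/-- The orbit with the parameters `q` stays outside the disc of radius `R` from the time `0` until a
time in `(T₀ - ρ, T₀ + ρ)`, at which it enters the disc; up to the time `T₀ + ρ` it satisfies the
bounds `C` on the position and `C'` on the velocity. -/
structure ReturnsNear (R T₀ ρ C C' : ℝ) (Z V : ℝ → (Fin N → ℂ) × ℝ × ℝ → ℂ)
    (q : (Fin N → ℂ) × ℝ × ℝ) : Prop where
  mem_Ioo : ∀ S, 0 < S → S ≤ T₀ + ρ → ‖Z S q‖ = R → S ∈ Ioo (T₀ - ρ) (T₀ + ρ)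
  norm_lt : ‖Z (T₀ + ρ) q‖ < R
  outside : ∀ S ∈ Ioo (T₀ - ρ) (T₀ + ρ), ‖Z S q‖ = R → ∀ t ∈ Ioo 0 S, R < ‖Z t q‖
  position_le : ∀ t ∈ Icc 0 (T₀ + ρ), ‖Z t q‖ ≤ C
  velocity_le : ∀ t ∈ Icc 0 (T₀ + ρ), ‖V t q‖ ≤ C'

/-- Being outside the disc is not an open condition at the two ends, where `r = R`. There it is
replaced by the sign of the radial velocity, which is strict: `‖Z‖` increases near `0` and decreases
on `[T₀ - ρ, T₀ + ρ]`. In between `r > R` strictly, and compactness applies. The prescribed `ρ₀`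
allows the window to fit in the neighbourhood of the implicit function theorem. -/
theorem IsOrbitFamily.exists_eventually_returnsNear (hR : 0 < R)
    (h : IsOrbitFamily α m R β T₀ r w U Z V) {M : ℝ} (hα : 0 < α) (hM : 0 < M)
    (hE : 1 < M / (α * R ^ α)) (hr : IsRadialOrbit α M R β T₀ r w) {ρ₀ : ℝ} (hρ₀ : 0 < ρ₀) :
    ∃ ρ > 0, ρ ≤ ρ₀ ∧ ρ < β ∧ ρ < T₀ ∧ ∀ᶠ q in 𝓝 0, q ∈ U ∧
      ReturnsNear R T₀ ρ (2 * (M / α) ^ (1 / α)) (2 * √(2 * (-1 + M / (α * R ^ α)))) Z V q := by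
  have hβ := hr.margin_pos
  have hT := hr.time_pos
  have hIcc : Icc 0 T₀ ⊆ Ioo (-β) (T₀ + β) := hr.Icc_subset
  have hw₀ : 0 < √(2 * (-1 + M / (α * R ^ α))) := Real.sqrt_pos.mpr (by linarith)
  set w₀ := √(2 * (-1 + M / (α * R ^ α)))
  have hrmax : 0 < (M / α) ^ (1 / α) := by positivity
  set rmax := (M / α) ^ (1 / α)
  have h0I : (0 : ℝ) ∈ Ioo (-β) (T₀ + β) := ⟨by linarith, by linarith⟩
  have hTI : T₀ ∈ Ioo (-β) (T₀ + β) := ⟨by linarith, by linarith⟩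
  have hrc : ∀ t ∈ Ioo (-β) (T₀ + β), ContinuousAt r t := fun t ht =>
    ((hr.hasDeriv t (Ioo_subset_Icc_self ht)).hasDerivAt (Icc_mem_nhds ht.1 ht.2)).continuousAt
  have hwc : ∀ t ∈ Ioo (-β) (T₀ + β), ContinuousAt w t := fun t ht =>
    ((hr.hasDeriv' t (Ioo_subset_Icc_self ht)).hasDerivAt (Icc_mem_nhds ht.1 ht.2)).continuousAt
  have hinner : ∀ t ∈ Ioo (-β) (T₀ + β), inner ℝ (Z t 0) (V t 0) = r t * w t := by
    intro t ht
    rw [h.radial t ht, h.radial' t ht, Complex.inner]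
    simp [mul_comm]
  -- times near `0` and near `T₀`
  obtain ⟨t₁, ht₁, ht₁'⟩ : ∃ t₁ > 0, ∀ t, |t| ≤ t₁ → 0 < r t * w t := by
    have := ((hrc 0 h0I).mul (hwc 0 h0I)).eventually (lt_mem_nhds (b := r 0 * w 0) (a := 0)
      (by rw [hr.start, hr.start']; positivity))
    obtain ⟨δ, hδ, hδ'⟩ := Metric.eventually_nhds_iff.mp this
    exact ⟨δ / 2, by positivity, fun t ht => hδ' (by rw [Real.dist_eq, sub_zero]; linarith)⟩
  obtain ⟨t₂, ht₂, ht₂'⟩ : ∃ t₂ > 0, ∀ t, |t - T₀| ≤ t₂ →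
      r t * w t < 0 ∧ |r t| < 2 * rmax ∧ |w t| < 2 * w₀ := by
    have h1 := ((hrc T₀ hTI).mul (hwc T₀ hTI)).eventually (gt_mem_nhds
      (show r T₀ * w T₀ < 0 by rw [hr.finish]; exact mul_neg_of_pos_of_neg hR hr.finish'))
    have h2 := (hrc T₀ hTI).abs.eventually (gt_mem_nhds (show |r T₀| < 2 * rmax by
      have := hr.le T₀ (right_mem_Icc.mpr hT.le)
      rw [abs_of_pos (by rw [hr.finish]; exact hR)]
      linarith))
    have h3 := (hwc T₀ hTI).abs.eventually (gt_mem_nhds (show |w T₀| < 2 * w₀ by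
      have := hr.abs_le T₀ (right_mem_Icc.mpr hT.le)
      linarith))
    obtain ⟨δ, hδ, hδ'⟩ := Metric.eventually_nhds_iff.mp (h1.and (h2.and h3))
    exact ⟨δ / 2, by positivity, fun t ht => hδ' (by rw [Real.dist_eq]; linarith)⟩
  obtain ⟨ρ, hρ, hρρ₀, hρβ, hρT, hρ₂⟩ : ∃ ρ > 0, ρ ≤ ρ₀ ∧ ρ < β ∧ ρ < T₀ ∧ ρ ≤ t₂ := by
    refine ⟨min (min ρ₀ t₂) (min (β / 2) (T₀ / 2)), by positivity, ?_, ?_, ?_, ?_⟩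
    · exact (min_le_left _ _).trans (min_le_left _ _)
    · exact ((min_le_right _ _).trans (min_le_left _ _)).trans_lt (by linarith)
    · exact ((min_le_right _ _).trans (min_le_right _ _)).trans_lt (by linarith)
    · exact (min_le_left _ _).trans (min_le_right _ _)
  refine ⟨ρ, hρ, hρρ₀, hρβ, hρT, ?_⟩
  have hsub₁ : Icc 0 (min t₁ T₀) ⊆ Ioo (-β) (T₀ + β) :=
    (Icc_subset_Icc_right (min_le_right _ _)).trans hIcc
  have hsub₂ : Icc (min t₁ T₀) (T₀ - ρ) ⊆ Ioo (-β) (T₀ + β) :=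
    (Icc_subset_Icc (lt_min ht₁ hT).le (by linarith)).trans hIcc
  have hsub₃ : Icc (T₀ - ρ) (T₀ + ρ) ⊆ Ioo (-β) (T₀ + β) :=
    Icc_subset_Ioo (by linarith) (by linarith)
  have hsub₄ : Icc 0 (T₀ + ρ) ⊆ Ioo (-β) (T₀ + β) := Icc_subset_Ioo (by linarith) (by linarith)
  have hZ := h.contDiffOn.continuousOn
  have hV := h.contDiffOn'.continuousOn
  have hbase : ∀ {K : Set ℝ}, K ⊆ Ioo (-β) (T₀ + β) →
      ∀ t ∈ K, (t, (0 : (Fin N → ℂ) × ℝ × ℝ)) ∈ Ioo (-β) (T₀ + β) ×ˢ U :=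
    fun hK t ht => ⟨hK ht, h.zero_mem⟩
  have habs : ∀ t ∈ Icc (T₀ - ρ) (T₀ + ρ), |t - T₀| ≤ t₂ := fun t ht => by
    rw [abs_le]; constructor <;> linarith [ht.1, ht.2]
  have ev₁ := eventually_forall_mem_of_continuousOn h.isOpen_prod (hZ.inner (𝕜 := ℝ) hV)
    (isCompact_Icc (a := 0) (b := min t₁ T₀)) (hbase hsub₁) (isOpen_Ioi (a := (0 : ℝ)))
    (fun t ht => by
      change 0 < inner ℝ (Z t 0) (V t 0)
      rw [hinner t (hsub₁ ht)]
      exact ht₁' t (by rw [abs_of_nonneg ht.1]; exact ht.2.trans (min_le_left _ _)))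
  have ev₂ := eventually_forall_mem_of_continuousOn h.isOpen_prod hZ.norm
    (isCompact_Icc (a := min t₁ T₀) (b := T₀ - ρ)) (hbase hsub₂) (isOpen_Ioi (a := R))
    (fun t ht => by
      have h1 := hr.lt t ⟨(lt_min ht₁ hT).trans_le ht.1, by linarith [ht.2]⟩
      change R < ‖Z t 0‖
      rw [h.radial t (hsub₂ ht), Complex.norm_real, Real.norm_of_nonneg (by linarith)]
      exact h1)
  have ev₃ := eventually_forall_mem_of_continuousOn h.isOpen_prod (hZ.inner (𝕜 := ℝ) hV)
    (isCompact_Icc (a := T₀ - ρ) (b := T₀ + ρ)) (hbase hsub₃) (isOpen_Iio (a := (0 : ℝ)))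
    (fun t ht => by
      change inner ℝ (Z t 0) (V t 0) < 0
      rw [hinner t (hsub₃ ht)]
      exact (ht₂' t (habs t ht)).1)
  -- The radial orbit, still falling after `T₀`, is strictly inside the disc at `T₀ + ρ`.
  have ev₄ := eventually_forall_mem_of_continuousOn h.isOpen_prod hZ.norm
    (isCompact_singleton (x := T₀ + ρ)) (q₀ := 0)
    (fun t ht => by rw [mem_singleton_iff.mp ht]; exact ⟨⟨by linarith, by linarith⟩, h.zero_mem⟩)
    (isOpen_Iio (a := R))
    (fun t ht => by
      rw [mem_singleton_iff.mp ht]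
      have h1 := h.norm_lt_of_inner_neg h.zero_mem (s := T₀) (t := T₀ + ρ) (by linarith)
        ((Icc_subset_Icc_left (by linarith)).trans hsub₃) (fun t ht => by
          have ht' : t ∈ Icc (T₀ - ρ) (T₀ + ρ) := Icc_subset_Icc_left (by linarith) ht
          rw [hinner t (hsub₃ ht')]
          exact (ht₂' t (habs t ht')).1)
      rwa [h.radial T₀ hTI, hr.finish, Complex.norm_real, Real.norm_of_nonneg hR.le] at h1)
  have hbound : ∀ t ∈ Icc 0 (T₀ + ρ), |r t| < 2 * rmax ∧ |w t| < 2 * w₀ := by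
    intro t ht
    rcases le_or_gt t T₀ with htT | htT
    · have h1 := hr.le_radius (t := t) ⟨ht.1, htT⟩
      have h2 := hr.le t ⟨ht.1, htT⟩
      have h3 := hr.abs_le t ⟨ht.1, htT⟩
      rw [abs_of_pos (by linarith)]
      exact ⟨by linarith, by linarith⟩
    · exact (ht₂' t (habs t ⟨by linarith, ht.2⟩)).2
  have ev₅ := eventually_forall_mem_of_continuousOn h.isOpen_prod hZ.norm
    (isCompact_Icc (a := 0) (b := T₀ + ρ)) (hbase hsub₄) (isOpen_Iio (a := 2 * rmax))
    (fun t ht => by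
      change ‖Z t 0‖ < 2 * rmax
      rw [h.radial t (hsub₄ ht), Complex.norm_real]
      exact (hbound t ht).1)
  have ev₆ := eventually_forall_mem_of_continuousOn h.isOpen_prod hV.norm
    (isCompact_Icc (a := 0) (b := T₀ + ρ)) (hbase hsub₄) (isOpen_Iio (a := 2 * w₀))
    (fun t ht => by
      change ‖V t 0‖ < 2 * w₀
      rw [h.radial' t (hsub₄ ht), Complex.norm_real]
      exact (hbound t ht).2)
  filter_upwards [ev₁, ev₂, ev₃, ev₄, ev₅, ev₆] with q h₁ h₂ h₃ h₄ h₅ h₆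
  have hq : q ∈ U := (h₄ _ rfl).1.2
  have hout : ∀ t, 0 < t → t ≤ T₀ - ρ → R < ‖Z t q‖ := by
    intro t ht htT
    rcases le_or_gt t (min t₁ T₀) with htt | htt
    · have := h.norm_lt_of_inner_pos hq ht ((Icc_subset_Icc_right htt).trans hsub₁)
        (fun x hx => (h₁ x (Icc_subset_Icc_right htt hx)).2)
      rwa [h.start q hq, Complex.norm_real, Real.norm_of_nonneg hR.le] at this
    · exact (h₂ t ⟨htt.le, htT⟩).2
  have hlast : ‖Z (T₀ + ρ) q‖ < R := (h₄ _ rfl).2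
  refine ⟨hq, ?_, hlast, ?_, fun t ht => (h₅ t ht).2.le, fun t ht => (h₆ t ht).2.le⟩
  · intro S hS hST hSR
    refine ⟨?_, lt_of_le_of_ne hST ?_⟩
    · by_contra hcon
      exact (hout S hS (not_lt.mp hcon)).ne' hSR
    · rintro rfl
      exact hlast.ne hSR
  · intro S hS hSR t ht
    rcases le_or_gt t (T₀ - ρ) with htT | htT
    · exact hout t ht.1 htT
    · have hsub : Icc t S ⊆ Icc (T₀ - ρ) (T₀ + ρ) := Icc_subset_Icc htT.le hS.2.le
      rw [← hSR]
      exact h.norm_lt_of_inner_neg hq ht.2 (hsub.trans hsub₃) (fun x hx => (h₃ x (hsub hx)).2)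

end RotatingCentres

end

/-! ### Existence and uniqueness by shooting -/

open Set

noncomputable section

namespace RotatingCentres

open Filter Topology

variable {N : ℕ} {α : ℝ} {m : Fin N → ℝ} {R β T₀ : ℝ} {r w : ℝ → ℝ}
  {U : Set ((Fin N → ℂ) × ℝ × ℝ)} {Z V : ℝ → (Fin N → ℂ) × ℝ × ℝ → ℂ}

theorem IsOrbitFamily.solvesOn (h : IsOrbitFamily α m R β T₀ r w U Z V)
    {q : (Fin N → ℂ) × ℝ × ℝ} (hq : q ∈ U) {J : Set ℝ} (hJ : J ⊆ Ioo (-β) (T₀ + β)) :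
    SolvesOn α m q.1 q.2.1 (fun t => Z t q) (fun t => V t q) J := fun t ht =>
  ⟨(h.hasDerivAt q hq t (hJ ht)).hasDerivWithinAt, (h.hasDerivAt' q hq t (hJ ht)).hasDerivWithinAt⟩

/-- A solution which leaves the disc at the point `R` with energy `-1` and stays outside coincides
with the orbit of the family with the same parameters, and comes back at a time close to `T₀`. -/
theorem IsOrbitFamily.eqOn_of_solvesOn (hR : 0 < R) (h : IsOrbitFamily α m R β T₀ r w U Z V)
    {q : (Fin N → ℂ) × ℝ × ℝ} (hq : q ∈ U) {ρ C C' : ℝ} (hρ : 0 < T₀ + ρ) (hρβ : ρ < β)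
    (hβ : 0 < β) (hret : ReturnsNear R T₀ ρ C C' Z V q) {z v : ℝ → ℂ} {S : ℝ} (hS : 0 < S)
    (hz : SolvesOn α m q.1 q.2.1 z v (Icc 0 S)) (hz0 : z 0 = R) (hv0 : v 0 = initialVelocity α m R q)
    (hout : ∀ t ∈ Ioo 0 S, R < ‖z t‖) (hzS : ‖z S‖ = R) :
    S ∈ Ioo (T₀ - ρ) (T₀ + ρ) ∧ ∀ t ∈ Icc 0 S, z t = Z t q ∧ v t = V t q := by
  have hge : ∀ t ∈ Icc 0 S, R ≤ ‖z t‖ := by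
    intro t ht
    rcases ht.1.eq_or_lt with h | h
    · rw [← h, hz0, Complex.norm_real, Real.norm_of_nonneg hR.le]
    · rcases ht.2.eq_or_lt with h' | h'
      · rw [h', hzS]
      · exact (hout t ⟨h, h'⟩).le
  -- Nothing bounds `S` yet, and the family is controlled only up to `T₀ + β`, so the comparison
  -- stops at `T₀ + ρ`. A solution lasting longer would be inside the disc at that time.
  have heq : ∀ L ≤ S, L ≤ T₀ + ρ → ∀ t ∈ Icc 0 L, z t = Z t q ∧ v t = V t q := by
    intro L hLS hLT
    have hsub : Icc 0 L ⊆ Ioo (-β) (T₀ + β) := Icc_subset_Ioo (by linarith) (by linarith)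
    refine (hz.mono (Icc_subset_Icc_right hLS)).eqOn (r := R / 4) (by positivity)
      (h.centres_le q hq) (h.solvesOn hq hsub) (fun t ht => ?_) (fun t ht => ?_) ?_ ?_
    · linarith [hge t (Icc_subset_Icc_right hLS ht)]
    · linarith [h.half_lt q hq t (hsub ht)]
    · rw [hz0, h.start q hq]
    · rw [hv0, h.start' q hq]
  have hST : S ≤ T₀ + ρ := by
    by_contra hcon
    rw [not_le] at hcon
    have h1 := (heq (T₀ + ρ) hcon.le le_rfl (T₀ + ρ) ⟨hρ.le, le_rfl⟩).1
    have h2 := hout (T₀ + ρ) ⟨hρ, hcon⟩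
    rw [h1] at h2
    exact lt_asymm h2 hret.norm_lt
  have h3 := heq S le_rfl hST
  refine ⟨hret.mem_Ioo S hS hST ?_, h3⟩
  rw [← (h3 S ⟨hS.le, le_rfl⟩).1, hzS]

/-- The implicit function provides `τ` and `ω`; its local uniqueness becomes uniqueness among all
times because every competitor returns within `ρ ≤ ρ₀` of `T₀`. The target is allowed off the circle
so that `τ` and `ω` are `C¹` on an open ball; only the geometric conclusions need `‖p.2.2‖ = R`. -/
theorem IsOrbitFamily.exists_shooting (hR : 0 < R)
    (h : IsOrbitFamily α m R β T₀ r w U Z V) {M : ℝ} (hα : 0 < α) (hM : 0 < M)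
    (hE : 1 < M / (α * R ^ α)) (hr : IsRadialOrbit α M R β T₀ r w) :
    ∃ κ > 0, ∃ η > 0, ∃ τ ω : (Fin N → ℂ) × ℝ × ℂ → ℝ,
      ContDiffOn ℝ 1 τ (Metric.ball (0, 0, (R : ℂ)) κ) ∧
      ContDiffOn ℝ 1 ω (Metric.ball (0, 0, (R : ℂ)) κ) ∧
      ∀ p ∈ Metric.ball ((0, 0, (R : ℂ)) : (Fin N → ℂ) × ℝ × ℂ) κ,
        0 < τ p ∧ τ p < T₀ + β ∧ |ω p| < η ∧ (p.1, p.2.1, ω p) ∈ U ∧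
        Z (τ p) (p.1, p.2.1, ω p) = p.2.2 ∧
        (‖p.2.2‖ = R →
          (∀ t ∈ Ioo 0 (τ p), R < ‖Z t (p.1, p.2.1, ω p)‖) ∧
          (∀ t ∈ Icc 0 (τ p), ‖Z t (p.1, p.2.1, ω p)‖ ≤ 2 * (M / α) ^ (1 / α)) ∧
          (∀ t ∈ Icc 0 (τ p),
            ‖V t (p.1, p.2.1, ω p)‖ ≤ 2 * √(2 * (-1 + M / (α * R ^ α)))) ∧
          ∀ (S ω' : ℝ) (z v : ℝ → ℂ), 0 < S → |ω'| < η →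
            SolvesOn α m p.1 p.2.1 z v (Icc 0 S) → z 0 = R →
            v 0 = initialVelocity α m R (p.1, p.2.1, ω') →
            (∀ t ∈ Ioo 0 S, R < ‖z t‖) → z S = p.2.2 →
            S = τ p ∧ ∀ t ∈ Icc 0 S, z t = Z t (p.1, p.2.1, ω p)) := by
  have hβ := hr.margin_pos
  have hT := hr.time_pos
  set p₀ : (Fin N → ℂ) × ℝ × ℂ := (0, 0, (R : ℂ)) with hp₀
  have cdf := h.contDiffAt_shootingMap hr
  have hinv := h.isInvertible_fderiv_shootingMap hR hr
  let ψ : (Fin N → ℂ) × ℝ × ℂ → ℝ × ℝ := cdf.implicitFunction one_ne_zero hinv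
  have hf0 : shootingMap Z (p₀, T₀, 0) = 0 := by
    have h1 := h.radial T₀ ⟨by linarith, by linarith⟩
    change Z T₀ 0 - (R : ℂ) = 0
    rw [h1, hr.finish, sub_self]
  have hψ0 : ψ p₀ = (T₀, 0) := cdf.implicitFunction_apply_self one_ne_zero hinv
  have hψiff : ∀ᶠ x in 𝓝 (p₀, T₀, (0 : ℝ)), shootingMap Z x = 0 ↔ ψ x.1 = x.2 := by
    have := cdf.eventually_apply_eq_iff_implicitFunction one_ne_zero hinv
    rwa [hf0] at this
  have hψz : ∀ᶠ p in 𝓝 p₀, shootingMap Z (p, ψ p) = 0 := by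
    have := cdf.eventually_apply_implicitFunction one_ne_zero hinv
    rwa [hf0] at this
  have hψC : ContDiffAt ℝ 1 ψ p₀ := cdf.contDiffAt_implicitFunction one_ne_zero hinv
  obtain ⟨ρ₀, hρ₀, hball⟩ := Metric.eventually_nhds_iff.mp hψiff
  obtain ⟨ρ, hρ, hρρ₀, hρβ, hρT, hret⟩ :=
    h.exists_eventually_returnsNear hR hα hM hE hr hρ₀
  obtain ⟨η₀, hη₀, hret'⟩ := Metric.eventually_nhds_iff.mp hret
  -- Below `η₀` the return estimates hold; below `ρ₀` the equivalence in the implicit function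
  -- theorem holds. The radius `min κ₀ η` imposes the same on `a`, `ν` and `u`.
  set η := min η₀ ρ₀ with hη
  have hηpos : 0 < η := lt_min hη₀ hρ₀
  have hev : ∀ᶠ p in 𝓝 p₀, ContDiffAt ℝ 1 ψ p ∧ shootingMap Z (p, ψ p) = 0 ∧
      |(ψ p).1 - T₀| < ρ ∧ |(ψ p).2| < η := by
    refine (hψC.eventually (by simp)).and (hψz.and (Eventually.and ?_ ?_))
    · have h1 : ContinuousAt (fun p => |(ψ p).1 - T₀|) p₀ :=
        (hψC.continuousAt.fst.sub continuousAt_const).abs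
      exact h1.eventually (gt_mem_nhds (by simp [hψ0, hρ]))
    · have h1 : ContinuousAt (fun p => |(ψ p).2|) p₀ := hψC.continuousAt.snd.abs
      exact h1.eventually (gt_mem_nhds (by simp [hψ0, hηpos]))
  obtain ⟨κ₀, hκ₀, hκ⟩ := Metric.eventually_nhds_iff.mp hev
  refine ⟨min κ₀ η, lt_min hκ₀ hηpos, η, hηpos, fun p => (ψ p).1, fun p => (ψ p).2, ?_, ?_, ?_⟩
  · exact fun p hp => (contDiffAt_fst.comp p
      (hκ (lt_of_lt_of_le hp (min_le_left _ _))).1).contDiffWithinAt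
  · exact fun p hp => (contDiffAt_snd.comp p
      (hκ (lt_of_lt_of_le hp (min_le_left _ _))).1).contDiffWithinAt
  · rintro ⟨a, ν, u⟩ hp
    obtain ⟨-, hzero, hτ, hω⟩ := hκ (lt_of_lt_of_le hp (min_le_left _ _))
    have hpη := lt_of_lt_of_le (Metric.mem_ball.mp hp) (min_le_right κ₀ η)
    rw [hp₀, Prod.dist_eq, Prod.dist_eq, max_lt_iff, max_lt_iff] at hpη
    obtain ⟨haη, hνη, huη⟩ := hpη
    have hgood : ∀ ω', |ω'| < η → (a, ν, ω') ∈ U ∧ ReturnsNear R T₀ ρ (2 * (M / α) ^ (1 / α))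
        (2 * √(2 * (-1 + M / (α * R ^ α)))) Z V (a, ν, ω') := by
      intro ω' hω'
      refine hret' ?_
      rw [← Prod.mk_zero_zero, ← Prod.mk_zero_zero, Prod.dist_eq, Prod.dist_eq, max_lt_iff,
        max_lt_iff]
      have hη' : η ≤ η₀ := min_le_left _ _
      refine ⟨haη.trans_le hη', hνη.trans_le hη', ?_⟩
      rw [Real.dist_eq, sub_zero]
      exact hω'.trans_le hη'
    obtain ⟨hqU, hq⟩ := hgood _ hω
    obtain ⟨hτ1, hτ2⟩ := abs_lt.mp hτ
    have hZu : Z (ψ (a, ν, u)).1 (a, ν, (ψ (a, ν, u)).2) = u := sub_eq_zero.mp hzero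
    refine ⟨by linarith, by linarith, hω, hqU, hZu, fun hu => ⟨?_, ?_, ?_, ?_⟩⟩
    · exact hq.outside _ ⟨by linarith, by linarith⟩ (by rw [hZu]; exact hu)
    · exact fun t ht => hq.position_le t ⟨ht.1, by linarith [ht.2]⟩
    · exact fun t ht => hq.velocity_le t ⟨ht.1, by linarith [ht.2]⟩
    · intro S ω' z v hS hω' hz hz0 hv0 hout hzS
      obtain ⟨hU', hret''⟩ := hgood ω' hω'
      obtain ⟨hSI, heq⟩ := h.eqOn_of_solvesOn hR hU' (by linarith) hρβ hβ hret'' hS hz hz0 hv0 hout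
        (by rw [hzS]; exact hu)
      have hdist : dist ((a, ν, u), S, ω') (p₀, T₀, (0 : ℝ)) < ρ₀ := by
        have hη' : η ≤ ρ₀ := min_le_right _ _
        rw [Prod.dist_eq, hp₀, Prod.dist_eq, Prod.dist_eq, Prod.dist_eq]
        refine max_lt (max_lt (haη.trans_le hη') (max_lt (hνη.trans_le hη') (huη.trans_le hη')))
          (max_lt ?_ ?_)
        · rw [Real.dist_eq]
          refine lt_of_lt_of_le ?_ hρρ₀
          rw [abs_lt]; constructor <;> linarith [hSI.1, hSI.2]
        · rw [Real.dist_eq, sub_zero]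
          exact hω'.trans_le hη'
      have hS0 : shootingMap Z ((a, ν, u), S, ω') = 0 := by
        change Z S (a, ν, ω') - u = 0
        rw [← (heq S ⟨hS.le, le_rfl⟩).1, hzS, sub_self]
      have hψS : ψ (a, ν, u) = (S, ω') := (hball hdist).mp hS0
      refine ⟨by simp only [hψS], fun t ht => ?_⟩
      simp only [hψS]
      exact (heq t ht).1

end RotatingCentres

end

/-! ### Outer solutions as first-order solutions, and the rotation to `p₀ = R` -/

open Set

noncomputable section

namespace RotatingCentres

open Filter Topology

variable {N : ℕ} {α : ℝ} {m : Fin N → ℝ}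

theorem SolvesOn.velocity_eq {a : Fin N → ℂ} {ν T : ℝ} {z v : ℝ → ℂ} (hT : 0 < T)
    (h : SolvesOn α m a ν z v (Icc 0 T)) {t : ℝ} (ht : t ∈ Icc 0 T) : velocity T z t = v t :=
  (h t ht).1.derivWithin (uniqueDiffOn_Icc hT t ht)

theorem SolvesOn.acceleration_eq {a : Fin N → ℂ} {ν T : ℝ} {z v : ℝ → ℂ} (hT : 0 < T)
    (h : SolvesOn α m a ν z v (Icc 0 T)) {t : ℝ} (ht : t ∈ Icc 0 T) :
    acceleration T z t = centredForce α m a ν (z t) - 2 * (ν : ℂ) * Complex.I * v t := by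
  have h1 : HasDerivWithinAt (velocity T z)
      (centredForce α m a ν (z t) - 2 * (ν : ℂ) * Complex.I * v t) (Icc 0 T) t :=
    (h t ht).2.congr (fun s hs => h.velocity_eq hT hs) (h.velocity_eq hT ht)
  exact h1.derivWithin (uniqueDiffOn_Icc hT t ht)

theorem SolvesOn.contDiffOn_two {a : Fin N → ℂ} {ν T : ℝ} {z v : ℝ → ℂ} (hT : 0 < T)
    (h : SolvesOn α m a ν z v (Icc 0 T)) (hv : ContDiffOn ℝ 1 v (Icc 0 T)) :
    ContDiffOn ℝ 2 z (Icc 0 T) := by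
  rw [show (2 : WithTop ℕ∞) = 1 + 1 by norm_num,
    contDiffOn_succ_iff_derivWithin (uniqueDiffOn_Icc hT)]
  exact ⟨fun t ht => (h t ht).1.differentiableWithinAt, by simp,
    hv.congr fun t ht => h.velocity_eq hT ht⟩

theorem SolvesOn.isOuterSolution {c : Fin N → ℂ} {ε ν T : ℝ} {p₀ p₁ : ℂ} {z v : ℝ → ℂ}
    (hα : 0 < α) (hT : 0 < T) (h : SolvesOn α m (scaledCentres ε c) ν z v (Icc 0 T))
    (hv : ContDiffOn ℝ 1 v (Icc 0 T))
    (hz : ∀ t ∈ Icc 0 T, ∀ k, z t ≠ scaledCentres ε c k)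
    (hE : 1 / 2 * ‖v 0‖ ^ 2 - centredPotential α m (scaledCentres ε c) ν (z 0) = -1)
    (hout : ∀ t ∈ Ioo 0 T, circularRadius α (totalMass m) < ‖z t‖)
    (h0 : z 0 = p₀) (h1 : z T = p₁) : IsOuterSolution α m c ε ν p₀ p₁ T z where
  time_pos := hT
  contDiffOn := h.contDiffOn_two hT hv
  motion t ht := by
    rw [h.acceleration_eq hT ht, h.velocity_eq hT ht, effectivePotential_eq,
      gradient_centredPotential hα m ν (hz t ht)]
    ring
  jacobi t ht := by
    rw [h.velocity_eq hT ht, effectivePotential_eq, h.energy_eq hα hz ht, hE]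
  outside := hout
  start := h0
  finish := h1

theorem IsOuterSolution.solvesOn {c : Fin N → ℂ} {ε ν T : ℝ} {p₀ p₁ : ℂ} {z : ℝ → ℂ}
    (hα : 0 < α) (h : IsOuterSolution α m c ε ν p₀ p₁ T z)
    (hz : ∀ t ∈ Icc 0 T, ∀ k, z t ≠ scaledCentres ε c k) :
    SolvesOn α m (scaledCentres ε c) ν z (velocity T z) (Icc 0 T) := by
  have h2 := h.contDiffOn
  rw [show (2 : WithTop ℕ∞) = 1 + 1 by norm_num,
    contDiffOn_succ_iff_derivWithin (uniqueDiffOn_Icc h.time_pos)] at h2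
  intro t ht
  refine ⟨(h2.1 t ht).hasDerivWithinAt, ?_⟩
  have h3 := h.motion t ht
  rw [effectivePotential_eq, gradient_centredPotential hα m ν (hz t ht)] at h3
  rw [← h3, add_sub_cancel_right]
  exact (h2.2.2.differentiableOn one_ne_zero t ht).hasDerivWithinAt

theorem norm_sq_initialVelocity {R : ℝ} {q : (Fin N → ℂ) × ℝ × ℝ} (h : 0 ≤ radialSpeedSq α m R q) :
    ‖initialVelocity α m R q‖ ^ 2 = 2 * (centredPotential α m q.1 q.2.1 R - 1) := by
  rw [← Complex.normSq_eq_norm_sq, Complex.normSq_apply]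
  simp only [initialVelocity, Complex.add_re, Complex.ofReal_re, Complex.mul_re, Complex.I_re,
    Complex.ofReal_im, Complex.I_im, Complex.add_im, Complex.mul_im]
  have := Real.mul_self_sqrt h
  rw [radialSpeedSq] at this ⊢
  linear_combination this

/-- A curve which starts at the point `R` and stays outside the disc of radius `R` has non-negative
radial velocity at the time `0`. -/
theorem re_nonneg_of_outside {R S : ℝ} (hR : 0 < R) (hS : 0 < S) {z : ℝ → ℂ} {v : ℂ}
    (hz : HasDerivWithinAt z v (Icc 0 S) 0) (hz0 : z 0 = R) (hout : ∀ t ∈ Ioo 0 S, R < ‖z t‖) :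
    0 ≤ v.re := by
  have h1 := (hz.norm_sq).mono Ioo_subset_Icc_self
  rw [hasDerivWithinAt_iff_tendsto_slope' (by simp), nhdsWithin_Ioo_eq_nhdsGT hS] at h1
  have h2 : 0 ≤ 2 * inner ℝ (z 0) v := by
    refine ge_of_tendsto h1 ?_
    filter_upwards [Ioo_mem_nhdsGT hS] with t ht
    rw [slope_def_field, hz0, Complex.norm_real, Real.norm_of_nonneg hR.le, sub_zero]
    refine div_nonneg (sub_nonneg.mpr ?_) ht.1.le
    exact pow_le_pow_left₀ hR.le (hout t ht).le 2
  rw [hz0, Complex.inner] at h2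
  simp at h2
  nlinarith

/-- The energy gives the square of the radial component, and its sign selects the root. -/
theorem eq_initialVelocity {R : ℝ} {a : Fin N → ℂ} {ν ω : ℝ} {v : ℂ} (hre : 0 ≤ v.re)
    (him : v.im = R * ω) (hE : 1 / 2 * ‖v‖ ^ 2 - centredPotential α m a ν R = -1) :
    v = initialVelocity α m R (a, ν, ω) := by
  have h1 : v.re ^ 2 = radialSpeedSq α m R (a, ν, ω) := by
    rw [← Complex.normSq_eq_norm_sq, Complex.normSq_apply, him] at hE
    rw [radialSpeedSq]
    linear_combination 2 * hE
  apply Complex.ext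
  · simp [initialVelocity, ← h1, Real.sqrt_sq hre]
  · simp [initialVelocity, him]

theorem norm_circlePoint {R : ℝ} (hR : 0 ≤ R) (θ : ℝ) : ‖circlePoint R θ‖ = R := by
  simp [circlePoint, Complex.norm_exp_ofReal_mul_I, abs_of_nonneg hR]

theorem contDiff_circlePoint (R : ℝ) : ContDiff ℝ 1 (circlePoint R) :=
  contDiff_const.mul ((Complex.ofRealCLM.contDiff.mul contDiff_const).cexp)

/-- The parameters `(a, ν, u)` of the problem in the frame in which `p₀` is the point `R`. -/
def normalisedData (R : ℝ) (a : Fin N → ℂ) (ν : ℝ) (p₀ p₁ : ℂ) : (Fin N → ℂ) × ℝ × ℂ :=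
  (fun k => (R / p₀) * a k, ν, (R / p₀) * p₁)

theorem norm_div_eq_one {R : ℝ} (hR : 0 < R) {p : ℂ} (hp : ‖p‖ = R) : ‖(R : ℂ) / p‖ = 1 := by
  rw [norm_div, hp, Complex.norm_real, Real.norm_of_nonneg hR.le, div_self hR.ne']

theorem normalisedData_mem_ball {R κ ε ν : ℝ} (hR : 0 < R) {a : Fin N → ℂ} (ha : ‖a‖ ≤ ε)
    (hε : ε < κ) (hν : |ν| < κ) {p₀ p₁ : ℂ} (hp₀ : ‖p₀‖ = R) (hp : ‖p₁ - p₀‖ < κ) :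
    normalisedData R a ν p₀ p₁ ∈ Metric.ball (0, 0, (R : ℂ)) κ := by
  have hu := norm_div_eq_one hR hp₀
  have hp0 : p₀ ≠ 0 := norm_ne_zero_iff.mp (by rw [hp₀]; exact hR.ne')
  rw [Metric.mem_ball, Prod.dist_eq, Prod.dist_eq]
  refine max_lt ?_ (max_lt ?_ ?_)
  · refine lt_of_le_of_lt ?_ hε
    rw [dist_pi_le_iff ((norm_nonneg a).trans ha)]
    intro k
    simp only [normalisedData, Pi.zero_apply, dist_zero_right, norm_mul, hu, one_mul]
    exact (norm_le_pi_norm a k).trans ha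
  · simpa [normalisedData] using hν
  · have : (R : ℂ) / p₀ * p₁ - R = R / p₀ * (p₁ - p₀) := by field_simp
    simp only [normalisedData, dist_eq_norm]
    rw [this, norm_mul, hu, one_mul]
    exact hp

theorem contDiff_normalisedData {R : ℝ} (hR : 0 < R) (a : Fin N → ℂ) (ν : ℝ) :
    ContDiff ℝ 1 fun θ : ℝ × ℝ => normalisedData R a ν (circlePoint R θ.1) (circlePoint R θ.2) := by
  have h0 : ∀ θ : ℝ × ℝ, circlePoint R θ.1 ≠ 0 := fun θ =>
    norm_ne_zero_iff.mp (by rw [norm_circlePoint hR.le]; exact hR.ne')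
  have h1 : ContDiff ℝ 1 fun θ : ℝ × ℝ => (R : ℂ) / circlePoint R θ.1 := by
    simp only [div_eq_mul_inv]
    exact contDiff_const.mul (((contDiff_circlePoint R).comp contDiff_fst).inv h0)
  exact ContDiff.prodMk (contDiff_pi.mpr fun k => h1.mul contDiff_const)
    (contDiff_const.prodMk (h1.mul ((contDiff_circlePoint R).comp contDiff_snd)))

end RotatingCentres

end

/-! ### Transfer between the rotated and the original frame -/

open Set

noncomputable section

namespace RotatingCentres

open Filter Topology

variable {N : ℕ} {α : ℝ} {m : Fin N → ℝ}

variable {R β T₀ : ℝ} {r w : ℝ → ℝ} {U : Set ((Fin N → ℂ) × ℝ × ℝ)}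
  {Z V : ℝ → (Fin N → ℂ) × ℝ × ℝ → ℂ}

theorem IsOrbitFamily.solvesOn_rotate (hR : 0 < R) (h : IsOrbitFamily α m R β T₀ r w U Z V)
    {a : Fin N → ℂ} {ν ω : ℝ} {p₀ : ℂ} (hp₀ : ‖p₀‖ = R)
    (hq : ((fun k => (R / p₀) * a k, ν, ω) : (Fin N → ℂ) × ℝ × ℝ) ∈ U) {J : Set ℝ}
    (hJ : J ⊆ Ioo (-β) (T₀ + β)) :
    SolvesOn α m a ν (fun t => p₀ / R * Z t (fun k => (R / p₀) * a k, ν, ω))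
      (fun t => p₀ / R * V t (fun k => (R / p₀) * a k, ν, ω)) J := by
  have hp0 : p₀ ≠ 0 := norm_ne_zero_iff.mp (by rw [hp₀]; exact hR.ne')
  have hR0 : (R : ℂ) ≠ 0 := by exact_mod_cast hR.ne'
  have hu : ‖p₀ / (R : ℂ)‖ = 1 := by
    rw [← inv_div, norm_inv, norm_div_eq_one hR hp₀, inv_one]
  have h1 := (h.solvesOn hq hJ).rotate hu
  have h2 : (fun k => p₀ / (R : ℂ) * ((R / p₀) * a k)) = a := by
    funext k
    field_simp
  simp only [h2] at h1
  exact h1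

theorem IsOrbitFamily.centre_norm_le (hR : 0 < R) (h : IsOrbitFamily α m R β T₀ r w U Z V)
    {a : Fin N → ℂ} {ν ω : ℝ} {p₀ : ℂ} (hp₀ : ‖p₀‖ = R)
    (hq : ((fun k => (R / p₀) * a k, ν, ω) : (Fin N → ℂ) × ℝ × ℝ) ∈ U) (k : Fin N) :
    ‖a k‖ ≤ R / 4 := by
  have h1 := (norm_le_pi_norm _ k).trans (h.centres_le _ hq)
  simpa only [norm_mul, norm_div_eq_one hR hp₀, one_mul] using h1

theorem angularVelocity_mul {p v : ℂ} (hR : 0 < R) (hp : ‖p‖ = R) :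
    angularVelocity p (p / R * v) = v.im / R := by
  have hR0 : (R : ℂ) ≠ 0 := by exact_mod_cast hR.ne'
  have h1 : (starRingEnd ℂ) p * (p / R * v) = (R : ℂ) * v := by
    have h2 : (starRingEnd ℂ) p * p = (R : ℂ) ^ 2 := by
      rw [mul_comm, Complex.mul_conj, Complex.normSq_eq_norm_sq, hp]; push_cast; ring
    calc (starRingEnd ℂ) p * (p / R * v) = ((starRingEnd ℂ) p * p) * v / R := by ring
      _ = _ := by rw [h2]; field_simp
  rw [angularVelocity, h1, hp, Complex.im_ofReal_mul]
  field_simp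

/-- The orbit is rotated back by `p₀ / R`; rotating the centres along with it leaves the equations
and the energy invariant. -/
theorem IsOrbitFamily.isOuterSolution (hα : 0 < α) (hR : 0 < R)
    (hRc : R = circularRadius α (totalMass m)) (h : IsOrbitFamily α m R β T₀ r w U Z V)
    (hβ : 0 < β) {c : Fin N → ℂ} {ε ν ω T : ℝ} {p₀ p₁ : ℂ} (hp₀ : ‖p₀‖ = R)
    (hq : ((fun k => (R / p₀) * scaledCentres ε c k, ν, ω) : (Fin N → ℂ) × ℝ × ℝ) ∈ U)
    (hT : 0 < T) (hTβ : T < T₀ + β)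
    (hout : ∀ t ∈ Ioo 0 T, R < ‖Z t (fun k => (R / p₀) * scaledCentres ε c k, ν, ω)‖)
    (hend : Z T (fun k => (R / p₀) * scaledCentres ε c k, ν, ω) = R / p₀ * p₁) :
    IsOuterSolution α m c ε ν p₀ p₁ T
      (fun t => p₀ / R * Z t (fun k => (R / p₀) * scaledCentres ε c k, ν, ω)) := by
  have hp0 : p₀ ≠ 0 := norm_ne_zero_iff.mp (by rw [hp₀]; exact hR.ne')
  have hR0 : (R : ℂ) ≠ 0 := by exact_mod_cast hR.ne'
  have hu : ‖p₀ / (R : ℂ)‖ = 1 := by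
    rw [← inv_div, norm_inv, norm_div_eq_one hR hp₀, inv_one]
  have hI : Icc 0 T ⊆ Ioo (-β) (T₀ + β) := Icc_subset_Ioo (by linarith) hTβ
  set q : (Fin N → ℂ) × ℝ × ℝ := (fun k => (R / p₀) * scaledCentres ε c k, ν, ω) with hqdef
  refine (h.solvesOn_rotate hR hp₀ hq hI).isOuterSolution hα hT ?_ ?_ ?_ ?_ ?_ ?_
  · have h1 : ContDiffOn ℝ 1 (fun t : ℝ => (t, q)) (Icc 0 T) := by fun_prop
    exact contDiffOn_const.mul (h.contDiffOn'.comp h1 fun t ht => ⟨hI ht, hq⟩)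
  · intro t ht k heq
    have h1 := h.half_lt q hq t (hI ht)
    have h2 := h.centre_norm_le hR hp₀ hq k
    have h3 := congrArg norm heq
    rw [norm_mul, hu, one_mul] at h3
    linarith
  · have h1 := norm_sq_initialVelocity (h.radialSpeedSq_pos q hq).le
    have h2 : p₀ / (R : ℂ) * Z 0 q = p₀ := by rw [h.start q hq]; field_simp
    have h3 := centredPotential_rotate α m (scaledCentres ε c) ν p₀ (norm_div_eq_one hR hp₀)
    rw [div_mul_cancel₀ _ hp0] at h3
    change 1 / 2 * ‖p₀ / (R : ℂ) * V 0 q‖ ^ 2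
      - centredPotential α m (scaledCentres ε c) ν (p₀ / (R : ℂ) * Z 0 q) = -1
    rw [h2, ← h3, norm_mul, hu, one_mul, h.start' q hq, h1]
    ring
  · intro t ht
    rw [norm_mul, hu, one_mul, ← hRc]
    exact hout t ht
  · rw [h.start q hq]; field_simp
  · rw [hend]; field_simp

/-- An outer solution, seen in the frame in which its starting point is `R`. -/
theorem IsOuterSolution.normalise (hα : 0 < α) (hR : 0 < R)
    (hRc : R = circularRadius α (totalMass m)) {c : Fin N → ℂ} {ε ν S : ℝ} {p₀ p₁ : ℂ}
    (hp₀ : ‖p₀‖ = R) (hp₁ : ‖p₁‖ = R) (hc : ∀ k, ‖scaledCentres ε c k‖ ≤ R / 4) {z : ℝ → ℂ}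
    (hz : IsOuterSolution α m c ε ν p₀ p₁ S z) :
    SolvesOn α m (fun k => (R / p₀) * scaledCentres ε c k) ν (fun t => R / p₀ * z t)
        (fun t => R / p₀ * velocity S z t) (Icc 0 S) ∧
      R / p₀ * z 0 = R ∧
      R / p₀ * velocity S z 0 = initialVelocity α m R (fun k => (R / p₀) * scaledCentres ε c k, ν,
        angularVelocity p₀ (velocity S z 0)) ∧
      (∀ t ∈ Ioo 0 S, R < ‖R / p₀ * z t‖) ∧ R / p₀ * z S = R / p₀ * p₁ := by
  have hp0 : p₀ ≠ 0 := norm_ne_zero_iff.mp (by rw [hp₀]; exact hR.ne')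
  have hR0 : (R : ℂ) ≠ 0 := by exact_mod_cast hR.ne'
  have hu : ‖(R : ℂ) / p₀‖ = 1 := norm_div_eq_one hR hp₀
  have hS := hz.time_pos
  have hncoll : ∀ t ∈ Icc 0 S, ∀ k, z t ≠ scaledCentres ε c k := by
    intro t ht k heq
    have h1 : R ≤ ‖z t‖ := by
      rcases ht.1.eq_or_lt with h | h
      · rw [← h, hz.start, hp₀]
      · rcases ht.2.eq_or_lt with h' | h'
        · rw [h', hz.finish, hp₁]
        · exact hRc ▸ (hz.outside t ⟨h, h'⟩).le
    have h2 := hc k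
    rw [← heq] at h2
    linarith
  have hsol := (hz.solvesOn hα hncoll).rotate hu
  have h0 : (R : ℂ) / p₀ * z 0 = R := by rw [hz.start, div_mul_cancel₀ _ hp0]
  have hout : ∀ t ∈ Ioo 0 S, R < ‖R / p₀ * z t‖ := fun t ht => by
    rw [norm_mul, hu, one_mul, hRc]
    exact hz.outside t ht
  have h0S : (0 : ℝ) ∈ Icc 0 S := ⟨le_rfl, hS.le⟩
  refine ⟨hsol, h0, eq_initialVelocity ?_ ?_ ?_, hout, by rw [hz.finish]⟩
  · exact re_nonneg_of_outside hR hS (hsol 0 h0S).1 h0 hout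
  · have h1 := angularVelocity_mul (v := (R : ℂ) / p₀ * velocity S z 0) hR hp₀
    rw [← mul_assoc, div_mul_div_comm, mul_comm p₀ (R : ℂ), div_self (mul_ne_zero hR0 hp0),
      one_mul] at h1
    rw [h1]; field_simp
  · have h1 := hz.jacobi 0 h0S
    rw [effectivePotential_eq, ← centredPotential_rotate α m (scaledCentres ε c) ν (z 0) hu, h0]
      at h1
    rw [norm_mul, hu, one_mul]
    exact h1

end RotatingCentres

end

/-! ### The proposition -/

theorem mainTheorem9 (N : ℕ) (hN : 3 ≤ N) (α : ℝ) (hα₁ : 1 ≤ α) (hα₂ : α < 2)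
    (m : Fin N → ℝ) (hm : ∀ k, 0 < m k)
    (c : Fin N → ℂ) (hc : c ≠ 0) (hbary : ∑ k, (m k : ℂ) * c k = 0)
    (M : ℝ) (hM : M = RotatingCentres.totalMass m)
    (R : ℝ) (hR : R = RotatingCentres.circularRadius α M) :
    ∃ δ > 0, ∃ ε₂ > 0, ∃ ν₁ > 0, ∃ η > 0,
      ∀ ε : ℝ, 0 < ε → ε < ε₂ → ∀ ν : ℝ, -ν₁ < ν → ν < ν₁ →
        ∃ (T : ℂ → ℂ → ℝ) (y : ℂ → ℂ → ℝ → ℂ),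
          (∀ p₀ p₁ : ℂ, ‖p₀‖ = R → ‖p₁‖ = R → ‖p₁ - p₀‖ < 2 * δ →
            (RotatingCentres.IsOuterSolution α m c ε ν p₀ p₁ (T p₀ p₁) (y p₀ p₁) ∧
              |RotatingCentres.angularVelocity p₀
                (RotatingCentres.velocity (T p₀ p₁) (y p₀ p₁) 0)| < η) ∧
            (∀ (S : ℝ) (z : ℝ → ℂ),
              RotatingCentres.IsOuterSolution α m c ε ν p₀ p₁ S z →
              |RotatingCentres.angularVelocity p₀ (RotatingCentres.velocity S z 0)| < η →
              S = T p₀ p₁ ∧ Set.EqOn z (y p₀ p₁) (Set.Icc 0 S)) ∧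
            (∀ t ∈ Set.Icc 0 (T p₀ p₁), ‖y p₀ p₁ t‖ ≤ 2 * (M / α) ^ (1 / α)) ∧
            (∀ t ∈ Set.Icc 0 (T p₀ p₁),
              ‖RotatingCentres.velocity (T p₀ p₁) (y p₀ p₁) t‖
                ≤ 2 * √(2 * (-1 + M / (α * R ^ α))))) ∧
          RotatingCentres.IsC1InEndpoints R δ T y := by
  open RotatingCentres in
  have hα : 0 < α := by linarith
  have hMpos : 0 < M := by
    rw [hM]
    have : Nonempty (Fin N) := ⟨⟨0, by omega⟩⟩
    exact Finset.sum_pos (fun k _ => hm k) Finset.univ_nonempty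
  have hbase : 0 < (2 - α) * M / (2 * α) :=
    div_pos (mul_pos (by linarith) hMpos) (by positivity)
  have hRpos : 0 < R := hR ▸ Real.rpow_pos_of_pos hbase _
  have hRα : R ^ α = (2 - α) * M / (2 * α) := by
    rw [hR, circularRadius, ← Real.rpow_mul hbase.le, one_div_mul_cancel hα.ne', Real.rpow_one]
  -- The ratio equals `2 / (2 - α)`.
  have hE : 1 < M / (α * R ^ α) := by
    rw [hRα, one_lt_div (mul_pos hα hbase)]
    have h1 : α * ((2 - α) * M / (2 * α)) = (2 - α) * M / 2 := by field_simp
    rw [h1]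
    nlinarith
  obtain ⟨β, T₀, r, w, hr⟩ := exists_isRadialOrbit hα hMpos hRpos hE
  have hβ := hr.margin_pos
  obtain ⟨U, Z, V, h⟩ := exists_isOrbitFamily (m := m) hα hRpos (hM ▸ hE) (hM ▸ hr)
  -- The orbit family has margin `β / 2`, and the radial orbit is restricted to match.
  replace hr := hr.shrink (half_pos hβ) (half_le_self hβ.le)
  obtain ⟨κ, hκ, η, hη, τ, ω, hτC, hωC, hsh⟩ := h.exists_shooting hRpos hα hMpos hE hr
  have hRc : R = circularRadius α (totalMass m) := hM ▸ hR
  have hβ2 := half_pos hβ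
  -- Rotation preserves distances, so `ε < κ`, `|ν| < κ` and `|p₁ - p₀| < 2δ = κ` put the normalised
  -- data in the ball of radius `κ`.
  refine ⟨κ / 2, half_pos hκ, κ, hκ, κ, hκ, η, hη, fun ε hε hεκ ν hν hν' => ?_⟩
  have hcn : ‖scaledCentres ε c‖ ≤ ε := (norm_scaledCentres hε.le hc).le
  let d : ℂ → ℂ → (Fin N → ℂ) × ℝ × ℂ := normalisedData R (scaledCentres ε c) ν
  let q : ℂ → ℂ → (Fin N → ℂ) × ℝ × ℝ := fun p₀ p₁ => ((d p₀ p₁).1, (d p₀ p₁).2.1, ω (d p₀ p₁))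
  have hd : ∀ p₀ p₁ : ℂ, ‖p₀‖ = R → ‖p₁ - p₀‖ < 2 * (κ / 2) →
      d p₀ p₁ ∈ Metric.ball ((0, 0, (R : ℂ)) : (Fin N → ℂ) × ℝ × ℂ) κ := fun p₀ p₁ hp₀ hp =>
    normalisedData_mem_ball hRpos hcn hεκ (abs_lt.mpr ⟨hν, hν'⟩) hp₀ (by linarith)
  have hvel : ∀ p₀ p₁ : ℂ, ‖p₀‖ = R → ‖p₁ - p₀‖ < 2 * (κ / 2) → ∀ t ∈ Set.Icc 0 (τ (d p₀ p₁)),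
      velocity (τ (d p₀ p₁)) (fun t => p₀ / R * Z t (q p₀ p₁)) t = p₀ / R * V t (q p₀ p₁) := by
    intro p₀ p₁ hp₀ hp t ht
    obtain ⟨hτ0, hτ1, -, hqU, -⟩ := hsh _ (hd p₀ p₁ hp₀ hp)
    exact (h.solvesOn_rotate hRpos hp₀ hqU
      (Set.Icc_subset_Ioo (by linarith) hτ1)).velocity_eq hτ0 ht
  refine ⟨fun p₀ p₁ => τ (d p₀ p₁), fun p₀ p₁ t => p₀ / R * Z t (q p₀ p₁), ?_, ?_⟩
  · intro p₀ p₁ hp₀ hp₁ hp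
    have hp0 : p₀ ≠ 0 := norm_ne_zero_iff.mp (by rw [hp₀]; exact hRpos.ne')
    have hR0 : (R : ℂ) ≠ 0 := by exact_mod_cast hRpos.ne'
    have hu : ‖p₀ / (R : ℂ)‖ = 1 := by
      rw [← inv_div, norm_inv, norm_div_eq_one hRpos hp₀, inv_one]
    obtain ⟨hτ0, hτ1, hω, hqU, hZ, hrest⟩ := hsh _ (hd p₀ p₁ hp₀ hp)
    have hun : ‖(d p₀ p₁).2.2‖ = R := by
      change ‖(R : ℂ) / p₀ * p₁‖ = R
      rw [norm_mul, norm_div_eq_one hRpos hp₀, one_mul, hp₁]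
    obtain ⟨hout, hpos, hvelb, huniq⟩ := hrest hun
    refine ⟨⟨h.isOuterSolution hα hRpos hRc hβ2 hp₀ hqU hτ0 hτ1 hout hZ, ?_⟩, ?_, ?_, ?_⟩
    · rw [hvel p₀ p₁ hp₀ hp 0 ⟨le_rfl, hτ0.le⟩, angularVelocity_mul hRpos hp₀, h.start' _ hqU]
      simpa [initialVelocity, hRpos.ne'] using hω
    · intro S z hz hz'
      obtain ⟨h1, h2, h3, h4, h5⟩ := hz.normalise hα hRpos hRc hp₀ hp₁
        (h.centre_norm_le hRpos hp₀ hqU)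
      obtain ⟨hS, heq⟩ := huniq S _ _ _ hz.time_pos hz' h1 h2 h3 h4 h5
      refine ⟨hS, fun t ht => ?_⟩
      have h6 := heq t ht
      change z t = p₀ / R * Z t (q p₀ p₁)
      rw [← h6]
      field_simp
    · intro t ht
      rw [norm_mul, hu, one_mul]
      exact hpos t ht
    · intro t ht
      rw [hvel p₀ p₁ hp₀ hp t ht, norm_mul, hu, one_mul]
      exact hvelb t ht
  · have hmem : ∀ θ ∈ closeAngles R (κ / 2), ‖circlePoint R θ.1‖ = R ∧
        ‖circlePoint R θ.2 - circlePoint R θ.1‖ < 2 * (κ / 2) := fun θ hθ =>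
      ⟨norm_circlePoint hRpos.le _, by rw [norm_sub_rev]; exact hθ⟩
    have hdC := contDiff_normalisedData hRpos (scaledCentres ε c) ν
    have hmaps : Set.MapsTo (fun θ : ℝ × ℝ => d (circlePoint R θ.1) (circlePoint R θ.2))
        (closeAngles R (κ / 2)) (Metric.ball (0, 0, (R : ℂ)) κ) := fun θ hθ =>
      hd _ _ (hmem θ hθ).1 (hmem θ hθ).2
    have hτ' : ContDiffOn ℝ 1 (fun θ : ℝ × ℝ => τ (d (circlePoint R θ.1) (circlePoint R θ.2)))
        (closeAngles R (κ / 2)) := hτC.comp hdC.contDiffOn hmaps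
    have hω' : ContDiffOn ℝ 1 (fun θ : ℝ × ℝ => ω (d (circlePoint R θ.1) (circlePoint R θ.2)))
        (closeAngles R (κ / 2)) := hωC.comp hdC.contDiffOn hmaps
    have hq' : ContDiffOn ℝ 1 (fun θ : ℝ × ℝ => q (circlePoint R θ.1) (circlePoint R θ.2))
        (closeAngles R (κ / 2)) :=
      hdC.fst.contDiffOn.prodMk (hdC.snd.fst.contDiffOn.prodMk hω')
    have hsnd : Set.MapsTo (Prod.snd : ℝ × ℝ × ℝ → ℝ × ℝ)
        (Set.Icc (0 : ℝ) 1 ×ˢ closeAngles R (κ / 2)) (closeAngles R (κ / 2)) := fun x hx => hx.2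
    have htq : ContDiffOn ℝ 1 (fun x : ℝ × ℝ × ℝ =>
        (x.1 * τ (d (circlePoint R x.2.1) (circlePoint R x.2.2)),
          q (circlePoint R x.2.1) (circlePoint R x.2.2)))
        (Set.Icc (0 : ℝ) 1 ×ˢ closeAngles R (κ / 2)) :=
      (contDiffOn_fst.mul (hτ'.comp contDiffOn_snd hsnd)).prodMk (hq'.comp contDiffOn_snd hsnd)
    have hIcc : ∀ x ∈ Set.Icc (0 : ℝ) 1 ×ˢ closeAngles R (κ / 2),
        x.1 * τ (d (circlePoint R x.2.1) (circlePoint R x.2.2)) ∈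
          Set.Icc 0 (τ (d (circlePoint R x.2.1) (circlePoint R x.2.2))) := by
      intro x hx
      obtain ⟨hτ0, -⟩ := hsh _ (hmaps hx.2)
      exact ⟨mul_nonneg hx.1.1 hτ0.le, mul_le_of_le_one_left hτ0.le hx.1.2⟩
    have hmaps' : Set.MapsTo (fun x : ℝ × ℝ × ℝ =>
        (x.1 * τ (d (circlePoint R x.2.1) (circlePoint R x.2.2)),
          q (circlePoint R x.2.1) (circlePoint R x.2.2)))
        (Set.Icc (0 : ℝ) 1 ×ˢ closeAngles R (κ / 2))
        (Set.Ioo (-(β / 2)) (T₀ + β / 2) ×ˢ U) := by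
      intro x hx
      obtain ⟨hτ0, hτ1, -, hqU, -⟩ := hsh _ (hmaps hx.2)
      have h1 := hIcc x hx
      exact ⟨⟨by linarith [h1.1], by linarith [h1.2]⟩, hqU⟩
    have hp' : ContDiff ℝ 1 fun x : ℝ × ℝ × ℝ => circlePoint R x.2.1 / (R : ℂ) := by
      simp only [div_eq_mul_inv]
      exact ((contDiff_circlePoint R).comp (contDiff_fst.comp contDiff_snd)).mul contDiff_const
    -- Time, position and velocity are compositions of `τ`, `Z` and `V` with `C¹` functions of the
    -- angles; `hvel` identifies the one-sided derivative with the rotated `V`.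
    refine ⟨hτ', hp'.contDiffOn.mul (h.contDiffOn.comp htq hmaps'), ?_⟩
    refine (hp'.contDiffOn.mul (h.contDiffOn'.comp htq hmaps')).congr fun x hx => ?_
    exact hvel _ _ (hmem x.2 hx.2).1 (hmem x.2 hx.2).2 _ (hIcc x hx)
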